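/- Let $S^2\subset\mathbb{R}^3$ be the unit sphere with the induced metric $g$, oriented by the outward normal, so that $(\mathrm{vol}_g)_x(v,w)=\det(x,v,w)$, and with the standard action of $SO(3)$. For $X=\begin{pmatrix}0&a&b\\-a&0&c\\-b&-c&0\end{pmatrix}\in\mathfrak{so}(3)$ put $\vec v_X=(c,-b,a)$, and let $h\colon\mathfrak{so}(3)\to\Omega^0(S^2)$, $h_X(x)=\langle\vec v_X,x\rangle$, be the canonical comoment map. Put $\omega'=\frac1{4\pi}\mathrm{vol}_g$, $\mu'=\frac1{4\pi}h$ and $\varpi'=\omega'+\mu'$. Conventions. The fundamental vector field of $X\in\mathfrak{so}(3)$ is $X_M(x)=\frac{d}{dt}\big|_{t=0}\exp(-tX)\cdot x$. An $SO(3)$-equivariant 2-form on $M$ is $\omega+\mu$, where $\omega$ is an invariant 2-form and $\mu\colon\mathfrak{so}(3)\to\Omega^0(M)$ is linear and equivariant; it is closed if $d\omega=0$ and $\iota_{X_M}\omega=d(\mu_X)$ for all $X$. A closed equivariant 2-form is $SO(3)$-equivariantly prequantizable if there are a principal $U(1)$-bundle $p\colon P\to M$ on which $SO(3)$ acts smoothly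 by bundle automorphisms covering its action on $M$, and an $SO(3)$-invariant connection form $\Xi\in\Omega^1(P,i\mathbb{R})$, such that $p^*\omega=\frac{i}{2\pi}\,d\Xi$ and $p^*\mu_X=-\frac{i}{2\pi}\,\Xi(X_P)$ for all $X\in\mathfrak{so}(3)$. A closed 2-form is integral if its de Rham class is in the image of $H^2(M,\mathbb{Z})\to H^2(M,\mathbb{R})$. Proposition. 1. $\varpi'$ is a closed $SO(3)$-equivariant 2-form on $S^2$. 2. $\omega'=\frac{1}{4\pi}\mathrm{vol}_g$ is integral. 3. Nevertheless $\varpi'$ is not $SO(3)$-equivariantly prequantizable. 4. For $Y=-2\pi\begin{pmatrix}0&-1&0\\1&0&0\\0&0&0\end{pmatrix}\in\mathfrak{so}(3)$ and the north pole $x=(0,0,1)$ one has $\exp(Y)=e$, $\exp(tY)\cdot x=x$ for all $t\in\mathbb{R}$, and $\exp(2\pi i\,\mu'_Y(x))=-1$. -/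

import Mathlib

open scoped Manifold ContDiff Topology
open Metric

noncomputable section

namespace EquivPrequant

universe u

/-! ### Differential forms on manifolds without boundary, modelled on `ℝⁿ` -/

/-- `k`-forms on `M` with values in `F` (no regularity imposed): a continuous alternating `k`-linear
map on every tangent space. -/
abbrev DForm (n : ℕ) (M : Type*) [TopologicalSpace M] [ChartedSpace (EuclideanSpace ℝ (Fin n)) M]
    (k : ℕ) (F : Type*) [NormedAddCommGroup F] [NormedSpace ℝ F] :=
  ∀ x : M, TangentSpace (𝓡 n) x [⋀^Fin k]→L[ℝ] F

section Forms

variable {n : ℕ} {M : Type*} [TopologicalSpace M] [ChartedSpace (EuclideanSpace ℝ (Fin n)) M]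
  {k : ℕ} {F : Type*} [NormedAddCommGroup F] [NormedSpace ℝ F]

/-- The expression of a form in the preferred chart at `x₀`: its pullback along the inverse of that
chart. It is meaningful on `(extChartAt (𝓡 n) x₀).target`, an open set. -/
def DForm.inChart (α : DForm n M k F) (x₀ : M) :
    EuclideanSpace ℝ (Fin n) → EuclideanSpace ℝ (Fin n) [⋀^Fin k]→L[ℝ] F :=
  fun u => (α ((extChartAt (𝓡 n) x₀).symm u)).compContinuousLinearMap
    (mfderiv 𝓘(ℝ, EuclideanSpace ℝ (Fin n)) (𝓡 n) (extChartAt (𝓡 n) x₀).symm u)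

/-- A form is smooth on `s` if all its chart expressions are. -/
def DForm.SmoothOn (α : DForm n M k F) (s : Set M) : Prop :=
  ∀ x₀ : M, ContDiffOn ℝ ∞ (α.inChart x₀)
    ((extChartAt (𝓡 n) x₀).target ∩ (extChartAt (𝓡 n) x₀).symm ⁻¹' s)

/-- A form is smooth if all its chart expressions are. -/
def DForm.Smooth (α : DForm n M k F) : Prop := α.SmoothOn Set.univ

/-- The exterior derivative, computed at `x` in the preferred chart at `x`. -/
def DForm.d (α : DForm n M k F) : DForm n M (k + 1) F := fun x =>
  (extDeriv (α.inChart x) (extChartAt (𝓡 n) x x)).compContinuousLinearMap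
    (mfderiv (𝓡 n) 𝓘(ℝ, EuclideanSpace ℝ (Fin n)) (extChartAt (𝓡 n) x) x)

/-- `α` is invariant under the map `f`, that is, `f^* α = α`. -/
def DForm.InvariantUnder (α : DForm n M k F) (f : M → M) : Prop :=
  ∀ x : M, (α (f x)).compContinuousLinearMap (mfderiv (𝓡 n) (𝓡 n) f x) = α x

/-- A real 2-form is integral if its de Rham class comes from an integral class under
`H²(M, ℤ) → H²(M, ℝ)`. The integral class is given by a Čech cocycle `m` of an open cover `U`,
and the zigzag of primitives `lam i` of `η` on `U i` and of functions `f i j` on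
`U i ∩ U j` says that the class of `m` corresponds to the class of `η` under the
Čech - de Rham isomorphism. -/
def IsIntegralForm (η : DForm n M 2 ℝ) : Prop :=
  ∃ (ι : Type) (U : ι → TopologicalSpace.Opens M) (lam : ι → DForm n M 1 ℝ)
    (f : ι → ι → M → ℝ) (m : ι → ι → ι → M → ℤ),
    (∀ x, ∃ i, x ∈ U i) ∧
    (∀ i, (lam i).SmoothOn (U i)) ∧
    (∀ i, ∀ x ∈ U i, (lam i).d x = η x) ∧
    (∀ i j, ContMDiffOn (𝓡 n) 𝓘(ℝ, ℝ) ∞ (f i j) (U i ∩ U j : Set M)) ∧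
    (∀ i j, ∀ x ∈ U i, x ∈ U j → ∀ v : TangentSpace (𝓡 n) x,
      lam j x ![v] - lam i x ![v] = mfderiv (𝓡 n) 𝓘(ℝ, ℝ) (f i j) x v) ∧
    (∀ i j l, ∀ x ∈ U i, x ∈ U j → x ∈ U l →
      f j l x - f i l x + f i j x = (m i j l x : ℝ)) ∧
    (∀ i j l, ContinuousOn (m i j l) (U i ∩ U j ∩ U l : Set M))

end Forms

/-! ### The group `SO(3)`, its Lie algebra and its exponential map -/

/-- The rotation group. -/
abbrev SO3 := Matrix.specialOrthogonalGroup (Fin 3) ℝ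

/-- The Lie algebra `𝔰𝔬(3)` of antisymmetric `3 × 3` matrices. -/
abbrev so3 := LieAlgebra.Orthogonal.so (Fin 3) ℝ

theorem mem_SO3_iff (A : Matrix (Fin 3) (Fin 3) ℝ) :
    A ∈ Matrix.specialOrthogonalGroup (Fin 3) ℝ ↔ A * A.transpose = 1 ∧ A.det = 1 := by
  rw [Matrix.mem_specialOrthogonalGroup_iff, Matrix.mem_orthogonalGroup_iff]

theorem exp_mul_transpose (X : Matrix (Fin 3) (Fin 3) ℝ) (hX : X.transpose = -X) :
    NormedSpace.exp X * (NormedSpace.exp X).transpose = 1 := by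
  rw [← Matrix.exp_transpose, hX, ← Matrix.exp_add_of_commute]
  · simp
  · exact (Commute.refl X).neg_right

theorem exp_mem_SO3 (X : so3) :
    NormedSpace.exp (X : Matrix (Fin 3) (Fin 3) ℝ) ∈ Matrix.specialOrthogonalGroup (Fin 3) ℝ := by
  have hX : (X : Matrix (Fin 3) (Fin 3) ℝ).transpose = -X :=
    (LieAlgebra.Orthogonal.mem_so _ _ _).1 X.2
  rw [mem_SO3_iff]
  refine ⟨exp_mul_transpose _ hX, ?_⟩
  set Z : Matrix (Fin 3) (Fin 3) ℝ := (1 / 2 : ℝ) • (X : Matrix (Fin 3) (Fin 3) ℝ) with hZ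
  have hZt : Z.transpose = -Z := by simp [hZ, hX]
  have h2 : (X : Matrix (Fin 3) (Fin 3) ℝ) = Z + Z := by
    rw [hZ, ← add_smul]; norm_num
  have h3 := congrArg Matrix.det (exp_mul_transpose Z hZt)
  rw [Matrix.det_mul, Matrix.det_transpose, Matrix.det_one] at h3
  rw [h2, Matrix.exp_add_of_commute _ _ (Commute.refl Z), Matrix.det_mul, h3]

/-- The exponential map `𝔰𝔬(3) → SO(3)`. -/
def expSO3 (X : so3) : SO3 := ⟨NormedSpace.exp (X : Matrix (Fin 3) (Fin 3) ℝ), exp_mem_SO3 X⟩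

/-- The adjoint action `Ad_A X = A X A⁻¹` (and `A⁻¹ = Aᵀ`). -/
def Ad (A : SO3) (X : so3) : so3 :=
  ⟨(A : Matrix (Fin 3) (Fin 3) ℝ) * (X : Matrix (Fin 3) (Fin 3) ℝ) *
      (A : Matrix (Fin 3) (Fin 3) ℝ).transpose, by
    have hX : (X : Matrix (Fin 3) (Fin 3) ℝ).transpose = -X :=
      (LieAlgebra.Orthogonal.mem_so _ _ _).1 X.2
    rw [LieAlgebra.Orthogonal.mem_so]
    simp [Matrix.transpose_mul, hX, Matrix.mul_assoc]⟩

section Equivariant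

variable {n : ℕ} {M : Type*} [TopologicalSpace M] [ChartedSpace (EuclideanSpace ℝ (Fin n)) M]

/-- Smoothness of an action map `SO(3) × M → M`, where `SO(3)` carries its structure of embedded
submanifold of the space of `3 × 3` matrices: smoothness along the subset
`SO(3) × M` of `ℝ^(3 × 3) × M`. Only the values of the map on this subset matter. -/
def IsSmoothAction (n : ℕ) (M : Type*) [TopologicalSpace M]
    [ChartedSpace (EuclideanSpace ℝ (Fin n)) M] [MulAction SO3 M] : Prop :=
  open Classical in
  ContMDiffOn (𝓘(ℝ, Fin 3 → Fin 3 → ℝ).prod (𝓡 n)) (𝓡 n) ∞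
    (fun q : (Fin 3 → Fin 3 → ℝ) × M =>
      if hq : Matrix.of q.1 ∈ Matrix.specialOrthogonalGroup (Fin 3) ℝ then
        (⟨Matrix.of q.1, hq⟩ : SO3) • q.2
      else q.2)
    {q | Matrix.of q.1 ∈ Matrix.specialOrthogonalGroup (Fin 3) ℝ}

/-- The fundamental vector field `X_M(x) = d/dt|₀ exp(-tX) x`. -/
def fundamentalField [MulAction SO3 M] (X : so3) (x : M) : TangentSpace (𝓡 n) x :=
  mfderiv 𝓘(ℝ, ℝ) (𝓡 n) (fun t : ℝ => expSO3 (-(t • X)) • x) (0 : ℝ) (1 : ℝ)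

/-- `η + μ` is an `SO(3)`-equivariant 2-form in the Cartan model: `η` is an invariant 2-form and
`μ : 𝔰𝔬(3) → Ω⁰(M)` is linear and equivariant. -/
structure IsEquivariantTwoForm [MulAction SO3 M] (η : DForm n M 2 ℝ) (μ : so3 →ₗ[ℝ] (M → ℝ)) :
    Prop where
  smooth_form : η.Smooth
  smooth_moment : ∀ X : so3, ContMDiff (𝓡 n) 𝓘(ℝ, ℝ) ∞ (μ X)
  invariant_form : ∀ g : SO3, η.InvariantUnder (fun x => g • x)
  invariant_moment : ∀ (g : SO3) (X : so3) (x : M), μ (Ad g X) (g • x) = μ X x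

/-- `D(η + μ) = 0`, that is, `dη = 0` and `ι_{X_M} η = d(μ_X)` for every `X`. -/
structure IsEquivariantlyClosed [MulAction SO3 M] (η : DForm n M 2 ℝ)
    (μ : so3 →ₗ[ℝ] (M → ℝ)) : Prop where
  closed : ∀ x, η.d x = 0
  moment : ∀ (X : so3) (x : M) (v : TangentSpace (𝓡 n) x),
    η x ![fundamentalField X x, v] = mfderiv (𝓡 n) 𝓘(ℝ, ℝ) (μ X) x v

end Equivariant

/-! ### Principal `U(1)`-bundles and connections -/

section Bundles

variable {n : ℕ} {M : Type*} [TopologicalSpace M] [ChartedSpace (EuclideanSpace ℝ (Fin n)) M]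
  {P : Type*} [TopologicalSpace P] [ChartedSpace (EuclideanSpace ℝ (Fin (n + 1))) P]
  [MulAction Circle P]

/-- `p : P → M` is a smooth principal `U(1)`-bundle over the `n`-manifold `M`. As `U(1)` is
commutative, the right action `y · z` is written as the left action `z • y`. -/
structure IsCircleBundle (p : P → M) : Prop where
  manifold : IsManifold (𝓡 (n + 1)) ∞ P
  smooth_proj : ContMDiff (𝓡 (n + 1)) (𝓡 n) ∞ p
  smooth_action : ContMDiff ((𝓡 1).prod (𝓡 (n + 1))) (𝓡 (n + 1)) ∞
    (fun q : Circle × P => q.1 • q.2)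
  proj_smul : ∀ (z : Circle) (y : P), p (z • y) = p y
  locally_trivial : ∀ x : M, ∃ e : Bundle.Trivialization Circle p, x ∈ e.baseSet ∧
    ContMDiffOn (𝓡 (n + 1)) ((𝓡 n).prod (𝓡 1)) ∞ e e.source ∧
    ContMDiffOn ((𝓡 n).prod (𝓡 1)) (𝓡 (n + 1)) ∞ e.toOpenPartialHomeomorph.symm e.target ∧
    ∀ y : P, p y ∈ e.baseSet → ∀ z : Circle, (e (z • y)).2 = z * (e y).2

/-- The generator of the structure group action, `ξ_P(y) = d/dt|₀ y · exp(it)`. -/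
def circleField (y : P) : TangentSpace (𝓡 (n + 1)) y :=
  mfderiv 𝓘(ℝ, ℝ) (𝓡 (n + 1)) (fun t : ℝ => Circle.exp t • y) (0 : ℝ) (1 : ℝ)

/-- `Ξ` is a connection form: a smooth, `U(1)`-invariant 1-form with values in `iℝ ⊆ ℂ` such that
`Ξ(ξ_P) = i`. -/
structure IsConnection (Ξ : DForm (n + 1) P 1 ℂ) : Prop where
  smooth : Ξ.Smooth
  imaginary : ∀ (y : P) (v : TangentSpace (𝓡 (n + 1)) y), (Ξ y ![v]).re = 0
  invariant : ∀ z : Circle, Ξ.InvariantUnder (fun y => z • y)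
  vertical : ∀ y : P, Ξ y ![circleField y] = Complex.I

/-- `SO(3)` acts smoothly on `P` by principal bundle automorphisms that cover its action on `M`. -/
structure IsEquivariantBundle [MulAction SO3 M] [MulAction SO3 P] (p : P → M) : Prop where
  smooth_action : IsSmoothAction (n + 1) P
  commutes : ∀ (g : SO3) (z : Circle) (y : P), g • (z • y) = z • (g • y)
  proj_smul : ∀ (g : SO3) (y : P), p (g • y) = g • p y

/-- `curv(Ξ) = η`, that is, `p^* η = (i / 2π) dΞ`. -/
def HasCurvature (p : P → M) (Ξ : DForm (n + 1) P 1 ℂ) (η : DForm n M 2 ℝ) : Prop :=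
  ∀ (y : P) (v w : TangentSpace (𝓡 (n + 1)) y),
    ((η (p y) ![mfderiv (𝓡 (n + 1)) (𝓡 n) p y v, mfderiv (𝓡 (n + 1)) (𝓡 n) p y w] : ℝ) : ℂ) =
      Complex.I / (2 * Real.pi) * Ξ.d y ![v, w]

/-- The momentum of `Ξ` is `μ`, that is, `μ_X ∘ p = -(i / 2π) Ξ(X_P)`. -/
def HasMomentum [MulAction SO3 P] (p : P → M) (Ξ : DForm (n + 1) P 1 ℂ)
    (μ : so3 →ₗ[ℝ] (M → ℝ)) : Prop :=
  ∀ (X : so3) (y : P),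
    ((μ X (p y) : ℝ) : ℂ) = -(Complex.I / (2 * Real.pi)) * Ξ y ![fundamentalField X y]

end Bundles

/-- The equivariant 2-form `η + μ` is `SO(3)`-equivariantly prequantizable: it is the equivariant
curvature `curv(Ξ) + μ^Ξ` of an `SO(3)`-invariant connection `Ξ` on an `SO(3)`-equivariant principal
`U(1)`-bundle `p : P → M`. -/
def IsEquivariantlyPrequantizable {n : ℕ} {M : Type u} [TopologicalSpace M]
    [ChartedSpace (EuclideanSpace ℝ (Fin n)) M] [MulAction SO3 M]
    (η : DForm n M 2 ℝ) (μ : so3 →ₗ[ℝ] (M → ℝ)) : Prop :=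
  ∃ (P : Type u) (_ : TopologicalSpace P) (_ : ChartedSpace (EuclideanSpace ℝ (Fin (n + 1))) P)
    (_ : MulAction Circle P) (_ : MulAction SO3 P) (p : P → M) (Ξ : DForm (n + 1) P 1 ℂ),
    IsCircleBundle (n := n) p ∧ IsEquivariantBundle (n := n) p ∧ IsConnection Ξ ∧
    (∀ g : SO3, Ξ.InvariantUnder (fun y => g • y)) ∧
    HasCurvature p Ξ η ∧ HasMomentum p Ξ μ

/-! ### The round sphere, its area form and the canonical comoment map -/

/-- The unit sphere in Euclidean space `ℝ³`, with Mathlib's (stereographic) smooth structure. -/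
abbrev S2 := sphere (0 : EuclideanSpace ℝ (Fin 3)) 1

theorem norm_mulVec_SO3 (A : SO3) (x : EuclideanSpace ℝ (Fin 3)) :
    ‖WithLp.toLp 2 ((A : Matrix (Fin 3) (Fin 3) ℝ).mulVec x.ofLp)‖ = ‖x‖ := by
  have hA : (A : Matrix (Fin 3) (Fin 3) ℝ).transpose * (A : Matrix (Fin 3) (Fin 3) ℝ) = 1 :=
    mul_eq_one_comm.1 ((mem_SO3_iff _).1 A.2).1
  have key : ∀ y : EuclideanSpace ℝ (Fin 3), ‖y‖ ^ 2 = y.ofLp ⬝ᵥ y.ofLp := by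
    intro y
    rw [EuclideanSpace.norm_sq_eq]
    simp [dotProduct, sq]
  have h : ‖WithLp.toLp 2 ((A : Matrix (Fin 3) (Fin 3) ℝ).mulVec x.ofLp)‖ ^ 2 = ‖x‖ ^ 2 := by
    rw [key, key]
    rw [Matrix.dotProduct_mulVec, Matrix.vecMul_mulVec, hA, Matrix.vecMul_one]
  exact (sq_eq_sq₀ (norm_nonneg _) (norm_nonneg _)).1 h

/-- `SO(3)` acts on the sphere by matrix-vector multiplication. -/
instance instMulActionSO3S2 : MulAction SO3 S2 where
  smul A x := ⟨WithLp.toLp 2 ((A : Matrix (Fin 3) (Fin 3) ℝ).mulVec (x : EuclideanSpace ℝ (Fin 3)).ofLp), by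
    rw [mem_sphere_zero_iff_norm, norm_mulVec_SO3]
    exact mem_sphere_zero_iff_norm.1 x.2⟩
  one_smul x := by
    apply Subtype.ext
    change WithLp.toLp 2 ((1 : Matrix (Fin 3) (Fin 3) ℝ).mulVec _) = _
    rw [Matrix.one_mulVec]
  mul_smul A B x := by
    apply Subtype.ext
    change WithLp.toLp 2 (((A : Matrix (Fin 3) (Fin 3) ℝ) * (B : Matrix (Fin 3) (Fin 3) ℝ)).mulVec _) =
      WithLp.toLp 2 ((A : Matrix (Fin 3) (Fin 3) ℝ).mulVec
        ((B : Matrix (Fin 3) (Fin 3) ℝ).mulVec _))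
    rw [Matrix.mulVec_mulVec]

/-- The determinant of three vectors of `ℝ³`, as an alternating form. -/
def detForm : EuclideanSpace ℝ (Fin 3) [⋀^Fin 3]→L[ℝ] ℝ :=
  { Matrix.detRowAlternating.compLinearMap
      (EuclideanSpace.equiv (Fin 3) ℝ).toLinearEquiv.toLinearMap with
    cont := by
      change Continuous fun v : Fin 3 → EuclideanSpace ℝ (Fin 3) =>
        Matrix.det (Matrix.of fun i j => v i j)
      fun_prop }

/-- The area form of the metric induced by `ℝ³`, for the orientation by the outward normal:
`vol_x(v, w) = det(x, v, w)`, where tangent vectors are viewed as vectors of `ℝ³`. -/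
def volS2 : DForm 2 S2 2 ℝ := fun x =>
  (detForm.curryLeft (x : EuclideanSpace ℝ (Fin 3))).compContinuousLinearMap
    (mfderiv (𝓡 2) 𝓘(ℝ, EuclideanSpace ℝ (Fin 3))
      (Subtype.val : S2 → EuclideanSpace ℝ (Fin 3)) x)

/-- The vector `(c, -b, a)` attached to `X = !![0, a, b; -a, 0, c; -b, -c, 0]`. -/
def axisVec (X : so3) : EuclideanSpace ℝ (Fin 3) :=
  !₂[(X : Matrix (Fin 3) (Fin 3) ℝ) 1 2, -(X : Matrix (Fin 3) (Fin 3) ℝ) 0 2,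
    (X : Matrix (Fin 3) (Fin 3) ℝ) 0 1]

/-- The canonical comoment map `h_X(x) = ⟨v_X, x⟩` of the sphere. -/
def comomentS2 : so3 →ₗ[ℝ] (S2 → ℝ) where
  toFun X x := inner ℝ (axisVec X) (x : EuclideanSpace ℝ (Fin 3))
  map_add' X Y := by
    funext x
    simp only [Pi.add_apply, ← inner_add_left]
    congr 1
    ext i
    fin_cases i <;> simp [axisVec, add_comm]
  map_smul' c X := by
    funext x
    simp only [Pi.smul_apply, RingHom.id_apply, smul_eq_mul]
    rw [← real_inner_smul_left]
    congr 1
    ext i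
    fin_cases i <;> simp [axisVec]

/-- The invariant 2-form `(1 / 4π) vol_g`. -/
def omegaPrime : DForm 2 S2 2 ℝ := fun x => (1 / (4 * Real.pi)) • volS2 x

/-- The comoment map `(1 / 4π) h`. -/
def muPrime : so3 →ₗ[ℝ] (S2 → ℝ) := (1 / (4 * Real.pi)) • comomentS2

/-- The north pole `(0, 0, 1)`. -/
def northPole : S2 := ⟨!₂[0, 0, 1], by simp [EuclideanSpace.norm_eq, Fin.sum_univ_three]⟩

/-- The infinitesimal generator of the rotations around the `z`-axis. -/
def zGenerator : so3 := ⟨!![0, -1, 0; 1, 0, 0; 0, 0, 0], by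
  rw [LieAlgebra.Orthogonal.mem_so]
  ext i j
  fin_cases i <;> fin_cases j <;> simp⟩

end EquivPrequant

end

open scoped Manifold ContDiff Topology
open Metric

noncomputable section

/-! Closedness: the sphere's forms are treated as restrictions of forms on `E3`. With `a = axisVec
X`, the fundamental field of `X` at `x` is `a × x`, and for `w` tangent at the unit vector `x` one
has `det(x, a × x, w) = ⟨a, w⟩`, which is the moment equation. Invariance holds because rotations
preserve inner products and determinants, hence cross products.

Integrality: away from one pole the form has the primitive `polePrimitive`. The primitives for the
two poles differ by `dφ / 2π`, with `φ` the longitude, so the transition functions are branches of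
the angle in full turns. Two branches differ by integers, and these form the Čech cocycle
(`restrictS2_polePrimitive_d`, `restrictS2_polePrimitive_sub`, `transition_cocycle`).

No prequantization: the obstruction sits in one fibre (`not_hasMomentum_muPrime`). The rotations
about the vertical axis fix the north pole, so they move a point `y` above it by `z t • y`, where
`z` is a one-parameter subgroup of the circle and therefore `z t = exp(iκt)`. Parametrized so that
`t = 1` is a full turn, this forces `z 1 = 1`. The momentum condition reads `κ / 2π = 1/2`
(`muPrime_northPole`), hence `κ = π` and `z 1 = -1`, a contradiction. -/

namespace EquivPrequant

/-! ### Smooth dependence of the pullback of an alternating map on the map and on the linear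
substitution. -/

section PullbackSmoothness

variable {E G H : Type*} [NormedAddCommGroup E] [NormedSpace ℝ E] [NormedAddCommGroup G]
  [NormedSpace ℝ G] [NormedAddCommGroup H] [NormedSpace ℝ H] {k : ℕ}

/-- Normalised antisymmetrisation, a continuous left inverse of the inclusion of alternating maps
into multilinear maps. -/
def antisymmetrization :
    ContinuousMultilinearMap ℝ (fun _ : Fin k => G) H →L[ℝ] G [⋀^Fin k]→L[ℝ] H :=
  LinearMap.mkContinuous
    { toFun := fun m => ((k.factorial : ℝ)⁻¹) • ContinuousMultilinearMap.alternatization m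
      map_add' := fun a b => by simp
      map_smul' := fun c a => by
        ext v
        simp [ContinuousMultilinearMap.alternatization_apply_apply, Finset.smul_sum, smul_comm c] }
    1 (by
      intro m
      refine ContinuousAlternatingMap.opNorm_le_bound _ (by positivity) fun v => ?_
      have hk : (0 : ℝ) < k.factorial := by exact_mod_cast k.factorial_pos
      have h1 : ‖∑ σ : Equiv.Perm (Fin k), Equiv.Perm.sign σ • m (v ∘ σ)‖ ≤
          ∑ _σ : Equiv.Perm (Fin k), ‖m‖ * ∏ i, ‖v i‖ := by
        refine norm_sum_le_of_le _ fun σ _ => ?_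
        have h2 : ‖m (v ∘ σ)‖ ≤ ‖m‖ * ∏ i, ‖v i‖ := by
          refine (m.le_opNorm _).trans_eq ?_
          rw [← Equiv.prod_comp σ fun i => ‖v i‖]
          rfl
        rcases Int.units_eq_one_or (Equiv.Perm.sign σ) with h | h <;> simpa [h] using h2
      have h3 : (((k.factorial : ℝ)⁻¹) • ContinuousMultilinearMap.alternatization m) v =
          ((k.factorial : ℝ)⁻¹) • ∑ σ : Equiv.Perm (Fin k), Equiv.Perm.sign σ • m (v ∘ σ) := by
        simp [ContinuousMultilinearMap.alternatization_apply_apply, Function.comp_def]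
      change ‖(((k.factorial : ℝ)⁻¹) • ContinuousMultilinearMap.alternatization m) v‖ ≤ _
      rw [h3, norm_smul, norm_inv, Real.norm_of_nonneg hk.le, one_mul, inv_mul_le_iff₀ hk]
      simpa [Fintype.card_perm] using h1)

/-- All `k!` signed permuted copies of an alternating map equal the map itself, hence so does their
average. -/
theorem antisymmetrization_apply_coe (a : G [⋀^Fin k]→L[ℝ] H) :
    antisymmetrization a.toContinuousMultilinearMap = a := by
  ext v
  have hk : (k.factorial : ℝ) ≠ 0 := by exact_mod_cast k.factorial_ne_zero
  change (((k.factorial : ℝ)⁻¹) •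
    ContinuousMultilinearMap.alternatization a.toContinuousMultilinearMap) v = a v
  have h (σ : Equiv.Perm (Fin k)) : Equiv.Perm.sign σ • a (v ∘ σ) = a v := by
    have := a.toAlternatingMap.map_perm v σ
    change a (v ∘ σ) = Equiv.Perm.sign σ • a v at this
    rw [this, smul_smul, Int.units_mul_self, one_smul]
  simp [ContinuousMultilinearMap.alternatization_apply_apply, h, Fintype.card_perm,
    ← Nat.cast_smul_eq_nsmul ℝ, smul_smul, hk]

/-- For multilinear maps, pullback is linear in the form and multilinear in the substitutions, hence
smooth. The result is brought back to alternating maps by the continuous linear retraction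
`antisymmetrization`. -/
theorem _root_.ContDiffOn.continuousAlternatingMapCompContinuousLinearMap
    {F : Type*} [NormedAddCommGroup F] [NormedSpace ℝ F] {r : WithTop ℕ∞} {s : Set E}
    {a : E → G [⋀^Fin k]→L[ℝ] H} {A : E → F →L[ℝ] G}
    (ha : ContDiffOn ℝ r a s) (hA : ContDiffOn ℝ r A s) :
    ContDiffOn ℝ r (fun x => (a x).compContinuousLinearMap (A x)) s := by
  have h1 : ContDiffOn ℝ r (fun x =>
      ContinuousMultilinearMap.compContinuousLinearMapContinuousMultilinear ℝ
        (fun _ : Fin k => F) (fun _ : Fin k => G) H (fun _ => A x)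
        (a x).toContinuousMultilinearMap) s := by
    refine ContDiffOn.clm_apply ?_ ?_
    · exact (ContinuousMultilinearMap.contDiff _).comp_contDiffOn (contDiffOn_pi.2 fun _ => hA)
    · exact (ContinuousAlternatingMap.toContinuousMultilinearMapCLM ℝ).contDiff.comp_contDiffOn ha
  refine (antisymmetrization.contDiff.comp_contDiffOn h1).congr fun x _ => ?_
  exact (antisymmetrization_apply_coe _).symm

end PullbackSmoothness

/-! ### Calculus on the sphere -/

/-- Euclidean three-space. -/
abbrev E3 := EuclideanSpace ℝ (Fin 3)

theorem contMDiff_val_S2 {r : WithTop ℕ∞} :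
    ContMDiff (𝓡 2) 𝓘(ℝ, E3) r (Subtype.val : S2 → E3) :=
  have : Fact (Module.finrank ℝ E3 = 2 + 1) := ⟨by simp⟩
  contMDiff_coe_sphere

theorem contMDiff_S2_of_val {F H N : Type*} [NormedAddCommGroup F] [NormedSpace ℝ F]
    [TopologicalSpace H] {I : ModelWithCorners ℝ F H} [TopologicalSpace N] [ChartedSpace H N]
    {r : WithTop ℕ∞} [IsManifold I r N] {f : N → S2}
    (hf : ContMDiff I 𝓘(ℝ, E3) r fun x => (f x : E3)) : ContMDiff I (𝓡 2) r f :=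
  have : Fact (Module.finrank ℝ E3 = 2 + 1) := ⟨by simp⟩
  hf.codRestrict_sphere fun x => (f x).2

/-- The differential of the inclusion of the sphere. -/
def dval (x : S2) : TangentSpace (𝓡 2) x →L[ℝ] E3 :=
  mfderiv (𝓡 2) 𝓘(ℝ, E3) (Subtype.val : S2 → E3) x

theorem mdifferentiableAt_val_S2 (x : S2) :
    MDifferentiableAt (𝓡 2) 𝓘(ℝ, E3) (Subtype.val : S2 → E3) x :=
  (contMDiff_val_S2 (r := 1) x).mdifferentiableAt one_ne_zero

theorem inner_dval (x : S2) (v : TangentSpace (𝓡 2) x) : inner ℝ (x : E3) (dval x v) = 0 := by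
  have : Fact (Module.finrank ℝ E3 = 2 + 1) := ⟨by simp⟩
  have h := range_mvfderiv_subtypeVal (n := 2) x
  have h2 : dval x v ∈ (ℝ ∙ (x : E3))ᗮ := by
    rw [← h]
    exact ⟨v, rfl⟩
  exact (Submodule.mem_orthogonal_singleton_iff_inner_right.1 h2)

/-- The inverse of the preferred chart at `x₀`, as a map into Euclidean space. -/
def param (x₀ : S2) (u : EuclideanSpace ℝ (Fin 2)) : E3 := (extChartAt (𝓡 2) x₀).symm u

/-- The preferred chart at `x₀` is the stereographic projection from `-x₀`, which is onto the plane.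
Hence `param x₀` is smooth everywhere and no domain has to be tracked. -/
theorem extChartAt_target_S2 (x₀ : S2) : (extChartAt (𝓡 2) x₀).target = Set.univ := by
  have : Fact (Module.finrank ℝ E3 = 2 + 1) := ⟨by simp⟩
  have h : (chartAt (EuclideanSpace ℝ (Fin 2)) x₀).target = Set.univ :=
    stereographic'_target (n := 2) (-x₀)
  rw [extChartAt_target, h]
  simp

theorem contMDiff_extChartAt_symm_S2 (x₀ : S2) :
    ContMDiff 𝓘(ℝ, EuclideanSpace ℝ (Fin 2)) (𝓡 2) ∞ (extChartAt (𝓡 2) x₀).symm := by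
  have h := contMDiffOn_extChartAt_symm (I := 𝓡 2) (n := ∞) x₀
  rw [extChartAt_target_S2] at h
  exact contMDiffOn_univ.1 h

theorem contDiff_param (x₀ : S2) : ContDiff ℝ ∞ (param x₀) :=
  (contMDiff_val_S2.comp (contMDiff_extChartAt_symm_S2 x₀)).contDiff

theorem fderiv_param (x₀ : S2) (u : EuclideanSpace ℝ (Fin 2)) :
    fderiv ℝ (param x₀) u = (dval ((extChartAt (𝓡 2) x₀).symm u)).comp
      (mfderiv 𝓘(ℝ, EuclideanSpace ℝ (Fin 2)) (𝓡 2) (extChartAt (𝓡 2) x₀).symm u) := by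
  rw [← mfderiv_eq_fderiv]
  exact mfderiv_comp u (mdifferentiableAt_val_S2 _)
    ((contMDiff_extChartAt_symm_S2 x₀ u).mdifferentiableAt (by simp))

/-- Near `x`, `param x` after the chart is the inclusion of the sphere; the chain rule does the
rest. -/
theorem fderiv_param_comp (x : S2) :
    (fderiv ℝ (param x) (extChartAt (𝓡 2) x x)).comp
      (mfderiv (𝓡 2) 𝓘(ℝ, EuclideanSpace ℝ (Fin 2)) (extChartAt (𝓡 2) x) x) = dval x := by
  have h1 : MDifferentiableAt (𝓡 2) 𝓘(ℝ, EuclideanSpace ℝ (Fin 2)) (extChartAt (𝓡 2) x) x :=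
    mdifferentiableAt_extChartAt (mem_chart_source _ x)
  have h2 : MDifferentiableAt 𝓘(ℝ, EuclideanSpace ℝ (Fin 2)) 𝓘(ℝ, E3) (param x)
      (extChartAt (𝓡 2) x x) :=
    ((contDiff_param x).differentiable (by simp) _).mdifferentiableAt
  rw [← mfderiv_eq_fderiv]
  refine (mfderiv_comp x h2 h1).symm.trans ?_
  refine Filter.EventuallyEq.mfderiv_eq ?_
  filter_upwards [extChartAt_source_mem_nhds (I := 𝓡 2) x] with y hy
  exact congrArg Subtype.val ((extChartAt (𝓡 2) x).left_inv hy)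

section AmbientForms

variable {k : ℕ} {F : Type*} [NormedAddCommGroup F] [NormedSpace ℝ F]

/-- The restriction to the sphere of a form on Euclidean space. -/
def restrictS2 (β : E3 → E3 [⋀^Fin k]→L[ℝ] F) : DForm 2 S2 k F := fun x =>
  (β x).compContinuousLinearMap (dval x)

theorem restrictS2_inChart (β : E3 → E3 [⋀^Fin k]→L[ℝ] F) (x₀ : S2) :
    (restrictS2 β).inChart x₀ =
      fun u => (β (param x₀ u)).compContinuousLinearMap (fderiv ℝ (param x₀) u) := by
  funext u
  rw [fderiv_param]
  rfl

theorem restrictS2_smoothOn {β : E3 → E3 [⋀^Fin k]→L[ℝ] F} {T : Set E3}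
    (hβ : ContDiffOn ℝ ∞ β T) : (restrictS2 β).SmoothOn (Subtype.val ⁻¹' T) := by
  intro x₀
  rw [restrictS2_inChart]
  refine ContDiffOn.continuousAlternatingMapCompContinuousLinearMap ?_ ?_
  · exact hβ.comp (contDiff_param x₀).contDiffOn fun u hu => hu.2
  · exact ((contDiff_param x₀).fderiv_right (m := ∞) (by simp)).contDiffOn

/-- The exterior derivative commutes with pullback along `param x`, and by `fderiv_param_comp` the
chart differential in `DForm.d` turns that pullback into restriction along `dval x`. Derivatives on
the sphere thus become derivatives in `E3`. -/
theorem restrictS2_d {β : E3 → E3 [⋀^Fin k]→L[ℝ] F} {x : S2} (hβ : DifferentiableAt ℝ β x) :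
    (restrictS2 β).d x = restrictS2 (extDeriv β) x := by
  have hx : param x (extChartAt (𝓡 2) x x) = x :=
    congrArg Subtype.val ((extChartAt (𝓡 2) x).left_inv (mem_extChartAt_source x))
  unfold DForm.d
  rw [restrictS2_inChart, extDeriv_pullback (r := 2) (by rwa [hx])
    ((contDiff_param x).contDiffAt.of_le (by norm_cast)) (by simp), hx]
  unfold restrictS2
  rw [← fderiv_param_comp]
  rfl

end AmbientForms

/-! ### The equivariant form on the sphere -/

theorem inner_E3 (x y : E3) : inner ℝ x y = x 0 * y 0 + x 1 * y 1 + x 2 * y 2 := by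
  simp [PiLp.inner_apply, Fin.sum_univ_three, mul_comm]

theorem sq_sum_S2 (x : S2) : (x : E3) 0 ^ 2 + (x : E3) 1 ^ 2 + (x : E3) 2 ^ 2 = 1 := by
  have h : inner ℝ (x : E3) (x : E3) = (1 : ℝ) := by
    rw [real_inner_self_eq_norm_sq, mem_sphere_zero_iff_norm.1 x.2, one_pow]
  rw [inner_E3] at h
  linarith

theorem detForm_apply (x y z : E3) : detForm ![x, y, z] =
    x 0 * y 1 * z 2 - x 0 * y 2 * z 1 - x 1 * y 0 * z 2 + x 1 * y 2 * z 0 + x 2 * y 0 * z 1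
      - x 2 * y 1 * z 0 := by
  change Matrix.det (Matrix.of fun i j => (![x, y, z] i) j) = _
  rw [Matrix.det_fin_three]
  simp

theorem volS2_apply (x : S2) (v w : TangentSpace (𝓡 2) x) :
    volS2 x ![v, w] = detForm ![(x : E3), dval x v, dval x w] := by
  change detForm (Matrix.vecCons (x : E3) (fun i => dval x (![v, w] i))) = _
  congr 1
  funext i
  fin_cases i <;> rfl

theorem omegaPrime_apply (x : S2) (v w : TangentSpace (𝓡 2) x) :
    omegaPrime x ![v, w] = 1 / (4 * Real.pi) * detForm ![(x : E3), dval x v, dval x w] := by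
  rw [← volS2_apply]
  rfl

theorem omegaPrime_eq_restrictS2 : omegaPrime =
    restrictS2 fun x : E3 => (1 / (4 * Real.pi)) • detForm.curryLeft x := rfl

theorem omegaPrime_smooth : omegaPrime.Smooth := by
  rw [omegaPrime_eq_restrictS2]
  refine restrictS2_smoothOn (T := Set.univ) ?_
  exact ((ContinuousAlternatingMap.curryLeft detForm).contDiff.const_smul _).contDiffOn

/-- The linear map of Euclidean space given by a matrix. -/
def matCLM (A : Matrix (Fin 3) (Fin 3) ℝ) : E3 →L[ℝ] E3 :=
  LinearMap.toContinuousLinearMap (Matrix.toEuclideanLin A)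

theorem matCLM_apply (A : Matrix (Fin 3) (Fin 3) ℝ) (v : E3) :
    matCLM A v = WithLp.toLp 2 (A.mulVec v.ofLp) := rfl

theorem coe_smul_S2 (g : SO3) (x : S2) :
    ((g • x : S2) : E3) = matCLM (g : Matrix (Fin 3) (Fin 3) ℝ) x := rfl

theorem detForm_matCLM (A : Matrix (Fin 3) (Fin 3) ℝ) (x y z : E3) :
    detForm ![matCLM A x, matCLM A y, matCLM A z] = A.det * detForm ![x, y, z] := by
  simp only [detForm_apply, matCLM_apply, Matrix.det_fin_three, Matrix.mulVec, dotProduct,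
    Fin.sum_univ_three]
  ring

theorem contMDiff_smul_S2 (g : SO3) : ContMDiff (𝓡 2) (𝓡 2) ∞ fun x : S2 => g • x :=
  contMDiff_S2_of_val ((matCLM g).contMDiff.comp contMDiff_val_S2)

theorem dval_mfderiv_smul (g : SO3) (x : S2) (v : TangentSpace (𝓡 2) x) :
    dval (g • x) (mfderiv (𝓡 2) (𝓡 2) (fun y : S2 => g • y) x v) = matCLM g (dval x v) := by
  have h1 := mfderiv_comp x (mdifferentiableAt_val_S2 (g • x))
    ((contMDiff_smul_S2 g x).mdifferentiableAt (by simp))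
  have h2 := mfderiv_comp x (I' := 𝓘(ℝ, E3)) (matCLM g).differentiableAt.mdifferentiableAt
    (mdifferentiableAt_val_S2 x)
  rw [mfderiv_eq_fderiv, ContinuousLinearMap.fderiv] at h2
  exact DFunLike.congr_fun (h1.symm.trans h2) v

theorem vec_two_eta {α : Type*} (v : Fin 2 → α) : v = ![v 0, v 1] := by
  funext i
  fin_cases i <;> rfl

theorem omegaPrime_invariant (g : SO3) : omegaPrime.InvariantUnder fun x => g • x := by
  intro x
  ext v
  have h : (omegaPrime (g • x)).compContinuousLinearMap
      (mfderiv (𝓡 2) (𝓡 2) (fun y : S2 => g • y) x) v =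
      omegaPrime (g • x) ![mfderiv (𝓡 2) (𝓡 2) (fun y : S2 => g • y) x (v 0),
        mfderiv (𝓡 2) (𝓡 2) (fun y : S2 => g • y) x (v 1)] := by
    change omegaPrime (g • x) _ = _
    congr 1
    funext i
    fin_cases i <;> rfl
  rw [h, omegaPrime_apply, dval_mfderiv_smul, dval_mfderiv_smul, coe_smul_S2, detForm_matCLM,
    ((mem_SO3_iff _).1 g.2).2, one_mul, ← omegaPrime_apply, ← vec_two_eta]

theorem muPrime_apply (X : so3) (x : S2) :
    muPrime X x = 1 / (4 * Real.pi) * inner ℝ (axisVec X) (x : E3) := rfl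

theorem muPrime_smooth (X : so3) : ContMDiff (𝓡 2) 𝓘(ℝ, ℝ) ∞ (muPrime X) := by
  have h : ContDiff ℝ ∞ fun y : E3 => 1 / (4 * Real.pi) * inner ℝ (axisVec X) y :=
    contDiff_const.mul (contDiff_const.inner ℝ contDiff_id)
  exact h.contMDiff.comp contMDiff_val_S2

theorem mfderiv_muPrime (X : so3) (x : S2) (v : TangentSpace (𝓡 2) x) :
    mfderiv (𝓡 2) 𝓘(ℝ, ℝ) (muPrime X) x v =
      1 / (4 * Real.pi) * inner ℝ (axisVec X) (dval x v) := by
  let L : E3 →L[ℝ] ℝ := (1 / (4 * Real.pi)) • innerSL ℝ (axisVec X)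
  have h2 := mfderiv_comp x (I' := 𝓘(ℝ, E3)) L.differentiableAt.mdifferentiableAt
    (mdifferentiableAt_val_S2 x)
  rw [mfderiv_eq_fderiv, ContinuousLinearMap.fderiv] at h2
  exact DFunLike.congr_fun h2 v

theorem so3_entries (X : so3) (i j : Fin 3) :
    (X : Matrix (Fin 3) (Fin 3) ℝ) i j = -(X : Matrix (Fin 3) (Fin 3) ℝ) j i := by
  have h := (LieAlgebra.Orthogonal.mem_so _ _ _).1 X.2
  exact congrFun (congrFun h j) i

theorem detForm_axisVec (X : so3) (u v : E3) :
    detForm ![axisVec X, u, v] = -inner ℝ (matCLM X u) v := by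
  have h00 := so3_entries X 0 0
  have h11 := so3_entries X 1 1
  have h22 := so3_entries X 2 2
  have h10 := so3_entries X 1 0
  have h20 := so3_entries X 2 0
  have h21 := so3_entries X 2 1
  have e00 : (X : Matrix (Fin 3) (Fin 3) ℝ) 0 0 = 0 := by linarith
  have e11 : (X : Matrix (Fin 3) (Fin 3) ℝ) 1 1 = 0 := by linarith
  have e22 : (X : Matrix (Fin 3) (Fin 3) ℝ) 2 2 = 0 := by linarith
  rw [detForm_apply, inner_E3]
  simp [axisVec, matCLM_apply, Matrix.mulVec, dotProduct, Fin.sum_univ_three, e00, e11, e22,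
    h10, h20, h21]
  ring

/-- The vector product of Euclidean three-space. -/
def crossE3 (u v : E3) : E3 :=
  !₂[u 1 * v 2 - u 2 * v 1, u 2 * v 0 - u 0 * v 2, u 0 * v 1 - u 1 * v 0]

theorem inner_crossE3 (u v w : E3) : inner ℝ (crossE3 u v) w = detForm ![u, v, w] := by
  rw [inner_E3, detForm_apply]
  simp [crossE3]
  ring

/-- The sign matches the convention `exp(-tX)`: the fundamental field is minus `X` applied to the
point, hence `axisVec X × x`. -/
theorem matCLM_so3 (X : so3) (u : E3) : -matCLM X u = crossE3 (axisVec X) u := by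
  refine ext_inner_right ℝ fun v => ?_
  rw [inner_crossE3, detForm_axisVec, inner_neg_left]

theorem crossE3_left_injective {a b : E3} (h : ∀ u, crossE3 a u = crossE3 b u) : a = b := by
  have h0 := h !₂[1, 0, 0]
  have h1 := h !₂[0, 1, 0]
  have e1 := congrArg (fun w : E3 => w 1) h0
  have e2 := congrArg (fun w : E3 => w 2) h0
  have e3 := congrArg (fun w : E3 => w 2) h1
  simp [crossE3] at e1 e2 e3
  ext i
  fin_cases i <;> simp [e1, e2, e3]

theorem matCLM_mul (A B : Matrix (Fin 3) (Fin 3) ℝ) (v : E3) :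
    matCLM (A * B) v = matCLM A (matCLM B v) := by
  simp [matCLM_apply]

theorem transpose_mul_SO3 (g : SO3) :
    (g : Matrix (Fin 3) (Fin 3) ℝ).transpose * (g : Matrix (Fin 3) (Fin 3) ℝ) = 1 :=
  mul_eq_one_comm.1 ((mem_SO3_iff _).1 g.2).1

theorem inner_matCLM_SO3 (g : SO3) (u v : E3) :
    inner ℝ (matCLM g u) (matCLM g v) = (inner ℝ u v : ℝ) := by
  have key : ∀ a b : E3, inner ℝ a b = a.ofLp ⬝ᵥ b.ofLp := by
    intro a b
    rw [inner_E3, dotProduct, Fin.sum_univ_three]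
  rw [key, key]
  change (g : Matrix (Fin 3) (Fin 3) ℝ).mulVec u.ofLp ⬝ᵥ
    (g : Matrix (Fin 3) (Fin 3) ℝ).mulVec v.ofLp = _
  rw [Matrix.dotProduct_mulVec, Matrix.vecMul_mulVec, transpose_mul_SO3, Matrix.vecMul_one]

theorem exists_matCLM_eq (g : SO3) (v : E3) : ∃ w, matCLM g w = v :=
  ⟨matCLM (g : Matrix (Fin 3) (Fin 3) ℝ).transpose v, by
    rw [← matCLM_mul, ((mem_SO3_iff _).1 g.2).1, matCLM_apply, Matrix.one_mulVec]⟩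

/-- The vector `axisVec X` is determined by the map `u ↦ axisVec X × u`, which is `-X`. Since `g`
preserves inner products and determinants, it preserves cross products, so conjugating `X` by `g`
rotates its axis by `g`. -/
theorem axisVec_Ad (g : SO3) (X : so3) : axisVec (Ad g X) = matCLM g (axisVec X) := by
  refine crossE3_left_injective fun u => ext_inner_right ℝ fun v => ?_
  obtain ⟨u, rfl⟩ := exists_matCLM_eq g u
  obtain ⟨v, rfl⟩ := exists_matCLM_eq g v
  have h : matCLM (Ad g X : so3) (matCLM g u) = matCLM g (matCLM X u) := by
    rw [← matCLM_mul, ← matCLM_mul]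
    congr 2
    change (g : Matrix (Fin 3) (Fin 3) ℝ) * _ * _ * _ = _
    rw [Matrix.mul_assoc, transpose_mul_SO3, Matrix.mul_one]
  rw [← matCLM_so3, h, inner_neg_left, inner_matCLM_SO3, inner_crossE3, detForm_matCLM,
    ((mem_SO3_iff _).1 g.2).2, one_mul, detForm_axisVec]

theorem muPrime_invariant (g : SO3) (X : so3) (x : S2) :
    muPrime (Ad g X) (g • x) = muPrime X x := by
  rw [muPrime_apply, muPrime_apply, axisVec_Ad, coe_smul_S2, inner_matCLM_SO3]

theorem isEquivariantTwoForm_prime : IsEquivariantTwoForm omegaPrime muPrime where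
  smooth_form := omegaPrime_smooth
  smooth_moment := muPrime_smooth
  invariant_form := omegaPrime_invariant
  invariant_moment := muPrime_invariant

theorem hasDerivAt_exp_smul_mulVec (A : Matrix (Fin 3) (Fin 3) ℝ) (v : E3) :
    ContDiff ℝ ∞ (fun t : ℝ => matCLM (NormedSpace.exp (t • A)) v) ∧
    HasDerivAt (fun t : ℝ => matCLM (NormedSpace.exp (t • A)) v) (matCLM A v) 0 := by
  -- A norm on matrices is chosen only to differentiate the exponential; the statement does not
  -- mention it.
  let _ : NormedRing (Matrix (Fin 3) (Fin 3) ℝ) := Matrix.linftyOpNormedRing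
  let _ : NormedAlgebra ℝ (Matrix (Fin 3) (Fin 3) ℝ) := Matrix.linftyOpNormedAlgebra
  let _ : NormedAlgebra ℚ (Matrix (Fin 3) (Fin 3) ℝ) := .restrictScalars ℚ ℝ _
  let L : Matrix (Fin 3) (Fin 3) ℝ →L[ℝ] E3 := LinearMap.toContinuousLinearMap
    { toFun := fun A => matCLM A v
      map_add' := fun A B => by simp [matCLM_apply, Matrix.add_mulVec]
      map_smul' := fun c A => by simp [matCLM_apply, Matrix.smul_mulVec] }
  constructor
  · have h : ContDiff ℝ ∞ fun t : ℝ => NormedSpace.exp (t • A) :=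
      (contDiff_iff_contDiffAt.2 fun B => (NormedSpace.exp_analytic B).contDiffAt).comp
        (contDiff_id.smul contDiff_const)
    exact L.contDiff.comp h
  · have h := hasDerivAt_exp_smul_const (𝕂 := ℝ) A (0 : ℝ)
    rw [zero_smul, NormedSpace.exp_zero, one_mul] at h
    exact L.hasFDerivAt.comp_hasDerivAt 0 h

theorem dval_fundamentalField (X : so3) (x : S2) :
    dval x (fundamentalField X x) = crossE3 (axisVec X) x := by
  have hc : ∀ t : ℝ, ((expSO3 (-(t • X)) • x : S2) : E3) =
      matCLM (NormedSpace.exp (t • (-(X : Matrix (Fin 3) (Fin 3) ℝ)))) x := by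
    intro t
    rw [coe_smul_S2, smul_neg]
    rfl
  obtain ⟨h1, h2⟩ := hasDerivAt_exp_smul_mulVec (-(X : Matrix (Fin 3) (Fin 3) ℝ)) x
  have hs : ContMDiff 𝓘(ℝ, ℝ) (𝓡 2) ∞ fun t : ℝ => expSO3 (-(t • X)) • x :=
    contMDiff_S2_of_val (by simpa only [hc] using h1.contMDiff)
  have h0 : expSO3 (-((0 : ℝ) • X)) • x = x := by
    apply Subtype.ext
    rw [hc, zero_smul, NormedSpace.exp_zero, matCLM_apply, Matrix.one_mulVec]
  have h3 := mfderiv_comp (0 : ℝ) (mdifferentiableAt_val_S2 (expSO3 (-((0 : ℝ) • X)) • x))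
    ((hs 0).mdifferentiableAt (by simp))
  have h4 : mfderiv 𝓘(ℝ, ℝ) 𝓘(ℝ, E3)
      ((Subtype.val : S2 → E3) ∘ fun t : ℝ => expSO3 (-(t • X)) • x) 0 (1 : ℝ) =
      crossE3 (axisVec X) x := by
    rw [mfderiv_eq_fderiv]
    have : ((Subtype.val : S2 → E3) ∘ fun t : ℝ => expSO3 (-(t • X)) • x) =
      fun t : ℝ => matCLM (NormedSpace.exp (t • (-(X : Matrix (Fin 3) (Fin 3) ℝ)))) x :=
      funext hc
    have e : matCLM (-(X : Matrix (Fin 3) (Fin 3) ℝ)) x = -matCLM X x := by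
      simp [matCLM_apply, Matrix.neg_mulVec]
    rw [this, h2.hasFDerivAt.fderiv, ← matCLM_so3, ← e]
    exact one_smul ℝ (matCLM (-(X : Matrix (Fin 3) (Fin 3) ℝ)) x)
  -- The chain rule yields `dval` at `expSO3 (-(0 • X)) • x`, which equals `x` only propositionally.
  -- All tangent spaces are the same model space, so the base point can be replaced.
  have key : ∀ y : S2, y = x → ∀ w : EuclideanSpace ℝ (Fin 2), dval x w = dval y w := by
    rintro _ rfl _
    rfl
  rw [h3] at h4
  exact (key _ h0 _).trans h4

theorem isEquivariantlyClosed_prime : IsEquivariantlyClosed omegaPrime muPrime where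
  closed x := by
    ext v
    -- A 3-form on a two-dimensional tangent space vanishes, as any three vectors are dependent.
    refine (omegaPrime.d x).toAlternatingMap.map_linearDependent v fun h => ?_
    have : FiniteDimensional ℝ (TangentSpace (𝓡 2) x) :=
      inferInstanceAs (FiniteDimensional ℝ (EuclideanSpace ℝ (Fin 2)))
    have h1 := h.fintype_card_le_finrank
    have h2 : Module.finrank ℝ (TangentSpace (𝓡 2) x) = 2 :=
      finrank_euclideanSpace_fin (𝕜 := ℝ) (n := 2)
    rw [h2, Fintype.card_fin] at h1
    omega
  moment X x v := by
    rw [omegaPrime_apply, mfderiv_muPrime, dval_fundamentalField]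
    congr 1
    have h1 := sq_sum_S2 x
    have h2 := inner_dval x v
    set w := dval x v
    rw [inner_E3] at h2 ⊢
    rw [detForm_apply]
    simp only [crossE3, PiLp.toLp_apply, Matrix.cons_val]
    set a := axisVec X
    -- This is `det(x, a × x, w) = ⟨a, w⟩⟨x, x⟩ - ⟨a, x⟩⟨x, w⟩` with `⟨x, x⟩ = 1` and `⟨x, w⟩ = 0`.
    linear_combination (a 0 * w 0 + a 1 * w 1 + a 2 * w 2) * h1 -
      (a 0 * (x : E3) 0 + a 1 * (x : E3) 1 + a 2 * (x : E3) 2) * h2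

/-! ### Integrality -/

theorem extDeriv_apply_pair {E F : Type*} [NormedAddCommGroup E] [NormedSpace ℝ E]
    [NormedAddCommGroup F] [NormedSpace ℝ F] {β : E → E [⋀^Fin 1]→L[ℝ] F} {x : E}
    (h : DifferentiableAt ℝ β x) (v w : E) :
    extDeriv β x ![v, w] =
      fderiv ℝ (fun y => β y ![w]) x v - fderiv ℝ (fun y => β y ![v]) x w := by
  have h0 : (0 : Fin 2).removeNth ![v, w] = ![w] := by
    funext i
    fin_cases i
    rfl
  have h1 : (1 : Fin 2).removeNth ![v, w] = ![v] := by
    funext i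
    fin_cases i
    rfl
  rw [extDeriv_apply h]
  refine (Fin.sum_univ_two _).trans ?_
  rw [h0, h1]
  simp [sub_eq_add_neg]

/-- The 1-form `(x₀ dx₁ - x₁ dx₀)` on Euclidean space. -/
def rotationForm (x : E3) : E3 →L[ℝ] ℝ :=
  x 0 • EuclideanSpace.proj (1 : Fin 3) - x 1 • EuclideanSpace.proj (0 : Fin 3)

theorem contDiff_coord (i : Fin 3) : ContDiff ℝ ∞ fun x : E3 => x i :=
  (EuclideanSpace.proj i : E3 →L[ℝ] ℝ).contDiff

theorem hasFDerivAt_coord (i : Fin 3) (x : E3) :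
    HasFDerivAt (fun x : E3 => x i) (EuclideanSpace.proj i : E3 →L[ℝ] ℝ) x :=
  (EuclideanSpace.proj i : E3 →L[ℝ] ℝ).hasFDerivAt

/-- A primitive of the area form, normalised to total area one, away from the pole `(0, 0, -s)`. -/
def polePrimitive (s : ℝ) (x : E3) : E3 [⋀^Fin 1]→L[ℝ] ℝ :=
  ContinuousAlternatingMap.ofSubsingletonLIE (𝕜 := ℝ) (E := E3) (F := ℝ) (0 : Fin 1)
    ((s / (4 * Real.pi) * (1 + s * x 2)⁻¹) • rotationForm x)

theorem contDiffAt_polePrimitive {s : ℝ} {x : E3} (hx : 1 + s * x 2 ≠ 0) :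
    ContDiffAt ℝ ∞ (polePrimitive s) x := by
  refine (ContinuousAlternatingMap.ofSubsingletonLIE (𝕜 := ℝ) (E := E3) (F := ℝ)
    (0 : Fin 1)).contDiff.contDiffAt.comp x (ContDiffAt.fun_smul ?_ ?_)
  · exact contDiffAt_const.mul
      ((contDiffAt_const.add (contDiffAt_const.mul (contDiff_coord 2).contDiffAt)).inv hx)
  · exact (((contDiff_coord 0).smul contDiff_const).sub
      ((contDiff_coord 1).smul contDiff_const)).contDiffAt

theorem fderiv_polePrimitive {s : ℝ} {x : E3} (hx : 1 + s * x 2 ≠ 0) (w : Fin 1 → E3) (v : E3) :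
    fderiv ℝ (fun y => polePrimitive s y w) x v =
      s / (4 * Real.pi) * (-(s * v 2) / (1 + s * x 2) ^ 2 * (x 0 * w 0 1 - x 1 * w 0 0)
        + (1 + s * x 2)⁻¹ * (v 0 * w 0 1 - v 1 * w 0 0)) := by
  have h1 := (((hasFDerivAt_coord 2 x).const_mul s).const_add 1)
  have h2 := (hasDerivAt_inv hx).comp_hasFDerivAt x h1
  have h3 := ((hasFDerivAt_coord 0 x).mul_const (w 0 1)).sub
    ((hasFDerivAt_coord 1 x).mul_const (w 0 0))
  have h4 := (h2.const_mul (s / (4 * Real.pi))).mul h3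
  have h5 : HasFDerivAt (fun y => polePrimitive s y w) _ x := h4
  rw [h5.fderiv]
  simp
  ring

/-- Both vectors are orthogonal to the unit vector `x`, so `v × w` is a multiple of `x`; pairing
with `x` gives the coefficient. -/
theorem cross_eq_smul_of_orthogonal {x v w : E3} (hx : x 0 ^ 2 + x 1 ^ 2 + x 2 ^ 2 = 1)
    (hv : inner ℝ x v = (0 : ℝ)) (hw : inner ℝ x w = (0 : ℝ)) (i : Fin 3) :
    crossE3 v w i = detForm ![x, v, w] * x i := by
  rw [inner_E3] at hv hw
  rw [detForm_apply]
  fin_cases i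
  · simp [crossE3]
    linear_combination (-(v 1 * w 2 - v 2 * w 1)) * hx + (x 1 * w 2 - x 2 * w 1) * hv
      + (x 2 * v 1 - x 1 * v 2) * hw
  · simp [crossE3]
    linear_combination (-(v 2 * w 0 - v 0 * w 2)) * hx + (x 2 * w 0 - x 0 * w 2) * hv
      + (x 0 * v 2 - x 2 * v 0) * hw
  · simp [crossE3]
    linear_combination (-(v 0 * w 1 - v 1 * w 0)) * hx + (x 0 * w 1 - x 1 * w 0) * hv
      + (x 1 * v 0 - x 0 * v 1) * hw

theorem restrictS2_polePrimitive_d {s : ℝ} (hs : s ^ 2 = 1) {x : S2}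
    (hx : 1 + s * (x : E3) 2 ≠ 0) : (restrictS2 (polePrimitive s)).d x = omegaPrime x := by
  have hd : DifferentiableAt ℝ (polePrimitive s) x :=
    (contDiffAt_polePrimitive hx).differentiableAt (by simp)
  rw [restrictS2_d hd]
  ext u
  rw [vec_two_eta u, omegaPrime_apply]
  have h : restrictS2 (extDeriv (polePrimitive s)) x ![u 0, u 1] =
      extDeriv (polePrimitive s) x ![dval x (u 0), dval x (u 1)] := by
    change extDeriv (polePrimitive s) x _ = _
    congr 1
    funext i
    fin_cases i <;> rfl
  rw [h, extDeriv_apply_pair hd]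
  have hv := inner_dval x (u 0)
  have hw := inner_dval x (u 1)
  set v := dval x (u 0)
  set w := dval x (u 1)
  have hq := sq_sum_S2 x
  have c := cross_eq_smul_of_orthogonal hq hv hw
  set l := detForm ![(x : E3), v, w]
  have c0 : v 1 * w 2 - v 2 * w 1 = l * (x : E3) 0 := c 0
  have c1 : v 2 * w 0 - v 0 * w 2 = l * (x : E3) 1 := c 1
  have c2 : v 0 * w 1 - v 1 * w 0 = l * (x : E3) 2 := c 2
  rw [fderiv_polePrimitive hx, fderiv_polePrimitive hx]
  simp only [Matrix.cons_val_zero]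
  have hp := Real.pi_ne_zero
  generalize (x : E3) 0 = a at *
  generalize (x : E3) 1 = b at *
  generalize (x : E3) 2 = z at *
  -- With `v × w = l x` the claim becomes polynomial: by `a² + b² = 1 - z²` and `s² = 1` both sides
  -- are `l (1 + 2sz + z²)`.
  have key : s * (s * (a * (l * a) + b * (l * b)) + 2 * (1 + s * z) * (l * z)) =
      (1 + s * z) ^ 2 * l := by
    linear_combination (s * s * l) * hq + (l * (1 - z ^ 2 ) + 2 * l * z ^ 2 - l * z ^ 2) * hs
  rw [← c0, ← c1, ← c2] at key
  field_simp
  linear_combination key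

/-! ### The cover of the sphere and the branches of the angle. -/

/-- Four open sets that cover the sphere: two open hemispheres around the poles and the complements
of two opposite closed meridians. -/
inductive Patch
  | north
  | south
  | front
  | back

/-- The projection of Euclidean space to the plane of the first two coordinates. -/
def planar : E3 →L[ℝ] ℂ :=
  Complex.ofRealCLM.comp (EuclideanSpace.proj (0 : Fin 3)) +
    Complex.I • Complex.ofRealCLM.comp (EuclideanSpace.proj (1 : Fin 3))

theorem planar_re (x : E3) : (planar x).re = x 0 := by simp [planar]

theorem planar_im (x : E3) : (planar x).im = x 1 := by simp [planar]

/-- The region of Euclidean space that cuts out a patch. -/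
def Patch.region : Patch → Set E3
  | north => {x | 0 < x 2}
  | south => {x | x 2 < 0}
  | front => {x | planar x ∈ Complex.slitPlane}
  | back => {x | -planar x ∈ Complex.slitPlane}

theorem Patch.isOpen_region (p : Patch) : IsOpen p.region := by
  cases p
  · exact isOpen_lt continuous_const (contDiff_coord 2).continuous
  · exact isOpen_lt (contDiff_coord 2).continuous continuous_const
  · exact Complex.isOpen_slitPlane.preimage planar.continuous
  · exact Complex.isOpen_slitPlane.preimage planar.continuous.neg

/-- The open set of the sphere that belongs to a patch. -/
def Patch.opens (p : Patch) : TopologicalSpace.Opens S2 :=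
  ⟨Subtype.val ⁻¹' p.region, p.isOpen_region.preimage continuous_subtype_val⟩

/-- The pole away from which the primitive on a patch is defined. -/
def Patch.sign : Patch → ℝ
  | south => -1
  | _ => 1

/-- The indicator of the southern patch. -/
def Patch.isSouth : Patch → ℝ
  | south => 1
  | _ => 0

/-- The indicator of the two patches along the equator. -/
def Patch.isEquatorial : Patch → ℝ
  | north => 0
  | south => 0
  | _ => 1

/-- The angle around the vertical axis, in units of full turns, on the equatorial patches. -/
def Patch.angle : Patch → E3 → ℝ
  | north => fun _ => 0
  | south => fun _ => 0
  | front => fun x => (Complex.log (planar x)).im / (2 * Real.pi)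
  | back => fun x => ((Complex.log (-planar x)).im + Real.pi) / (2 * Real.pi)

theorem Patch.sign_sq (p : Patch) : p.sign ^ 2 = 1 := by cases p <;> norm_num [Patch.sign]

theorem abs_lt_one_of_planar_ne_zero {x : S2} (h : planar x ≠ 0) :
    -1 < (x : E3) 2 ∧ (x : E3) 2 < 1 := by
  have hq := sq_sum_S2 x
  have hp : 0 < (x : E3) 0 ^ 2 + (x : E3) 1 ^ 2 := by
    have := Complex.normSq_pos.2 h
    rw [Complex.normSq_apply, planar_re, planar_im] at this
    linarith
  constructor <;> nlinarith

theorem Patch.planar_ne_zero {p : Patch} (hp : p.isEquatorial = 1) {x : E3} (hx : x ∈ p.region) :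
    planar x ≠ 0 := by
  cases p
  · simp [isEquatorial] at hp
  · simp [isEquatorial] at hp
  · exact Complex.slitPlane_ne_zero hx
  · exact neg_ne_zero.1 (Complex.slitPlane_ne_zero hx)

theorem Patch.one_add_pos {p : Patch} {x : S2} (hx : x ∈ p.opens) :
    0 < 1 + p.sign * (x : E3) 2 := by
  replace hx : (x : E3) ∈ p.region := hx
  cases p
  · have : 0 < (x : E3) 2 := hx
    simp only [sign]
    linarith
  · have : (x : E3) 2 < 0 := hx
    simp only [sign]
    linarith
  · have := (abs_lt_one_of_planar_ne_zero (planar_ne_zero (p := front) rfl hx)).1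
    simp only [sign]
    linarith
  · have := (abs_lt_one_of_planar_ne_zero (planar_ne_zero (p := back) rfl hx)).1
    simp only [sign]
    linarith

theorem exists_mem_opens (x : S2) : ∃ p : Patch, x ∈ p.opens := by
  rcases lt_trichotomy ((x : E3) 2) 0 with h | h | h
  · exact ⟨.south, h⟩
  · have hq := sq_sum_S2 x
    have h0 : planar x ≠ 0 := by
      intro h0
      have h1 := congrArg Complex.re h0
      have h2 := congrArg Complex.im h0
      rw [planar_re] at h1
      rw [planar_im] at h2
      simp [h, h1, h2] at hq
    rcases Complex.mem_slitPlane_or_neg_mem_slitPlane h0 with h1 | h1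
    · exact ⟨.front, h1⟩
    · exact ⟨.back, h1⟩
  · exact ⟨.north, h⟩

theorem contDiffAt_log_planar {L : E3 →L[ℝ] ℂ} {x : E3} (hx : L x ∈ Complex.slitPlane) :
    ContDiffAt ℝ ∞ (fun y => (Complex.log (L y)).im) x :=
  Complex.imCLM.contDiff.contDiffAt.comp x
    (((Complex.contDiffAt_log hx).restrict_scalars ℝ).comp x L.contDiff.contDiffAt)

/-- The derivative of `Im log (L x)` along `v` is `Im (L v / L x)`. -/
theorem fderiv_log_planar {L : E3 →L[ℝ] ℂ} {x : E3} (hx : L x ∈ Complex.slitPlane) (v : E3) :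
    fderiv ℝ (fun y => (Complex.log (L y)).im) x v =
      ((L x).re * (L v).im - (L x).im * (L v).re) / Complex.normSq (L x) := by
  have h1 := ((Complex.hasDerivAt_log hx).hasFDerivAt.restrictScalars ℝ).comp x L.hasFDerivAt
  have h2 := Complex.imCLM.hasFDerivAt.comp x h1
  refine (DFunLike.congr_fun h2.fderiv v).trans ?_
  simp [Complex.mul_im]
  ring

theorem Patch.contDiffAt_angle {p : Patch} {x : E3} (hx : x ∈ p.region) :
    ContDiffAt ℝ ∞ p.angle x := by
  cases p
  · exact contDiffAt_const
  · exact contDiffAt_const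
  · exact (contDiffAt_log_planar hx).div_const _
  · exact ((contDiffAt_log_planar (L := -planar) hx).add contDiffAt_const).div_const _

theorem Patch.fderiv_angle {p : Patch} {x : E3} (hx : x ∈ p.region) (v : E3) :
    fderiv ℝ p.angle x v =
      p.isEquatorial * ((x 0 * v 1 - x 1 * v 0) / (2 * Real.pi * (x 0 ^ 2 + x 1 ^ 2))) := by
  have hn : Complex.normSq (planar x) = x 0 ^ 2 + x 1 ^ 2 := by
    rw [Complex.normSq_apply, planar_re, planar_im]
    ring
  cases p
  · simp [angle, isEquatorial]
  · simp [angle, isEquatorial]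
  · have h := (((contDiffAt_log_planar hx).differentiableAt (by simp)).hasFDerivAt.mul_const
      (2 * Real.pi)⁻¹).fderiv
    have h2 := DFunLike.congr_fun h v
    rw [smul_apply, fderiv_log_planar hx, hn] at h2
    simp only [planar_re, planar_im] at h2
    refine h2.trans ?_
    simp only [isEquatorial, smul_eq_mul]
    field_simp
  · have h := ((((contDiffAt_log_planar (L := -planar) hx).differentiableAt
      (by simp)).hasFDerivAt.add_const Real.pi).mul_const (2 * Real.pi)⁻¹).fderiv
    have h2 := DFunLike.congr_fun h v
    rw [smul_apply, fderiv_log_planar (L := -planar) hx] at h2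
    simp only [neg_apply, Complex.normSq_neg, hn, Complex.neg_re,
      Complex.neg_im, planar_re, planar_im] at h2
    refine h2.trans ?_
    simp only [isEquatorial, smul_eq_mul]
    field_simp

/-! ### Transition functions and the integral Čech cocycle. -/

/-- The transition function between the primitives on two patches. -/
def transition (p q : Patch) (x : S2) : ℝ := p.isSouth * q.angle x - q.isSouth * p.angle x

theorem contDiffAt_transition {p q : Patch} {x : E3} (hp : x ∈ p.region) (hq : x ∈ q.region) :
    ContDiffAt ℝ ∞ (fun y => p.isSouth * q.angle y - q.isSouth * p.angle y) x :=
  (contDiffAt_const.mul (q.contDiffAt_angle hq)).sub (contDiffAt_const.mul (p.contDiffAt_angle hp))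

theorem contMDiffOn_transition (p q : Patch) :
    ContMDiffOn (𝓡 2) 𝓘(ℝ, ℝ) ∞ (transition p q) (p.opens ∩ q.opens : Set S2) := fun x hx =>
  ((contDiffAt_transition hx.1 hx.2).contMDiffAt.comp x (contMDiff_val_S2 x)).contMDiffWithinAt

theorem mfderiv_transition {p q : Patch} {x : S2} (hp : x ∈ p.opens) (hq : x ∈ q.opens)
    (v : TangentSpace (𝓡 2) x) :
    Eq (α := ℝ) (mfderiv (𝓡 2) 𝓘(ℝ, ℝ) (transition p q) x v)
      ((p.isSouth * q.isEquatorial - q.isSouth * p.isEquatorial) *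
        (((x : E3) 0 * dval x v 1 - (x : E3) 1 * dval x v 0) /
          (2 * Real.pi * ((x : E3) 0 ^ 2 + (x : E3) 1 ^ 2)))) := by
  have h1 := mfderiv_comp x (I' := 𝓘(ℝ, E3))
    ((contDiffAt_transition hp hq).differentiableAt (by simp)).mdifferentiableAt
    (mdifferentiableAt_val_S2 x)
  rw [mfderiv_eq_fderiv] at h1
  refine (DFunLike.congr_fun h1 v).trans ?_
  have h2 := (((q.contDiffAt_angle hq).differentiableAt (by simp)).hasFDerivAt.const_mul
    p.isSouth).sub (((p.contDiffAt_angle hp).differentiableAt (by simp)).hasFDerivAt.const_mul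
    q.isSouth)
  refine (DFunLike.congr_fun h2.fderiv (dval x v)).trans ?_
  change p.isSouth * fderiv ℝ q.angle x (dval x v) - q.isSouth * fderiv ℝ p.angle x (dval x v) = _
  rw [q.fderiv_angle hq, p.fderiv_angle hp]
  ring

theorem Patch.isSouth_cases (p : Patch) : p.isSouth = 0 ∧ p.sign = 1 ∨ p = south := by
  cases p <;> simp [isSouth, sign]

theorem Patch.of_mem_south {p : Patch} {x : S2} (hs : x ∈ south.opens) (hp : x ∈ p.opens) :
    p = south ∨ p.isSouth = 0 ∧ p.isEquatorial = 1 ∧ p.sign = 1 := by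
  cases p
  · exact absurd (show (0 : ℝ) < (x : E3) 2 from hp) (not_lt.2 (le_of_lt hs))
  all_goals simp [isSouth, sign, isEquatorial]

/-- Here `1/(1+z) + 1/(1-z) = 2/(1-z²)`, and `1 - z²` is the squared distance to the axis. With `r`
the value of `x₀ dx₁ - x₁ dx₀`, the right side is `dφ / 2π`: the factor `1/(4π)` is what makes the
period one. -/
theorem polePrimitive_sub_of_equatorial {x : S2} (h : planar x ≠ 0) (r : ℝ) :
    1 / (4 * Real.pi) * (1 + 1 * (x : E3) 2)⁻¹ * r
      - -1 / (4 * Real.pi) * (1 + -1 * (x : E3) 2)⁻¹ * r =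
      r / (2 * Real.pi * ((x : E3) 0 ^ 2 + (x : E3) 1 ^ 2)) := by
  obtain ⟨h1, h2⟩ := abs_lt_one_of_planar_ne_zero h
  have hq : (x : E3) 0 ^ 2 + (x : E3) 1 ^ 2 = (1 + (x : E3) 2) * (1 - (x : E3) 2) := by
    linear_combination sq_sum_S2 x
  have h3 : 1 + (x : E3) 2 ≠ 0 := by linarith
  have h4 : 1 - (x : E3) 2 ≠ 0 := by linarith
  have hp := Real.pi_ne_zero
  rw [hq, one_mul, neg_one_mul, ← sub_eq_add_neg]
  field_simp
  ring

theorem restrictS2_polePrimitive_apply (s : ℝ) (x : S2) (v : TangentSpace (𝓡 2) x) :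
    restrictS2 (polePrimitive s) x ![v] = s / (4 * Real.pi) * (1 + s * (x : E3) 2)⁻¹ *
      ((x : E3) 0 * dval x v 1 - (x : E3) 1 * dval x v 0) := rfl

theorem restrictS2_polePrimitive_sub {p q : Patch} {x : S2} (hp : x ∈ p.opens) (hq : x ∈ q.opens)
    (v : TangentSpace (𝓡 2) x) :
    Eq (α := ℝ)
      (restrictS2 (polePrimitive q.sign) x ![v] - restrictS2 (polePrimitive p.sign) x ![v])
      (mfderiv (𝓡 2) 𝓘(ℝ, ℝ) (transition p q) x v) := by
  refine Eq.trans ?_ (mfderiv_transition hp hq v).symm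
  rw [restrictS2_polePrimitive_apply, restrictS2_polePrimitive_apply]
  rcases p.isSouth_cases with ⟨hp1, hp2⟩ | rfl
  · rcases q.isSouth_cases with ⟨hq1, hq2⟩ | rfl
    · rw [hp1, hq1, hp2, hq2]
      ring
    · rcases Patch.of_mem_south hq hp with rfl | ⟨h1, h2, h3⟩
      · simp
      · have h := polePrimitive_sub_of_equatorial (Patch.planar_ne_zero h2 hp)
          ((x : E3) 0 * dval x v 1 - (x : E3) 1 * dval x v 0)
        rw [h1, h2, h3]
        simp only [Patch.isSouth, Patch.isEquatorial, Patch.sign]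
        linear_combination -h
  · rcases Patch.of_mem_south hp hq with rfl | ⟨h1, h2, h3⟩
    · simp
    · have h := polePrimitive_sub_of_equatorial (Patch.planar_ne_zero h2 hq)
        ((x : E3) 0 * dval x v 1 - (x : E3) 1 * dval x v 0)
      rw [h1, h2, h3]
      simp only [Patch.isSouth, Patch.isEquatorial, Patch.sign]
      linear_combination h

/-- On the overlap the planar projection is not real. The shift by `π` in the back branch makes the
branches agree where its imaginary part is positive; where it is negative they differ by a full
turn. -/
theorem Patch.front_angle_sub_back_angle {x : E3} (h1 : x ∈ front.region) (h2 : x ∈ back.region) :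
    ∃ m : ℤ, front.angle x - back.angle x = m := by
  have hp := Real.pi_ne_zero
  have him : (planar x).im ≠ 0 := by
    intro h
    have h1' : 0 < (planar x).re := by
      rcases h1 with h3 | h3
      · exact h3
      · exact absurd h h3
    rcases h2 with h3 | h3
    · rw [Complex.neg_re] at h3
      linarith
    · rw [Complex.neg_im, h, neg_zero] at h3
      exact h3 rfl
  simp only [angle, Complex.log_im]
  rcases lt_or_gt_of_ne him with h | h
  · refine ⟨-1, ?_⟩
    rw [Complex.arg_neg_eq_arg_add_pi_of_im_neg h]
    field_simp
    push_cast
    ring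
  · refine ⟨0, ?_⟩
    rw [Complex.arg_neg_eq_arg_sub_pi_of_im_pos h]
    field_simp
    push_cast
    ring

theorem Patch.angle_sub_angle {p q : Patch} (hp : p.isEquatorial = 1) (hq : q.isEquatorial = 1)
    {x : E3} (h1 : x ∈ p.region) (h2 : x ∈ q.region) : ∃ m : ℤ, p.angle x - q.angle x = m := by
  cases p <;> cases q <;> simp only [isEquatorial, zero_ne_one] at hp hq
  · exact ⟨0, by simp⟩
  · exact front_angle_sub_back_angle h1 h2
  · obtain ⟨m, hm⟩ := front_angle_sub_back_angle h2 h1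
    exact ⟨-m, by push_cast; linarith⟩
  · exact ⟨0, by simp⟩

theorem transition_cocycle {p q r : Patch} {x : S2} (hp : x ∈ p.opens) (hq : x ∈ q.opens)
    (hr : x ∈ r.opens) :
    ∃ m : ℤ, transition q r x - transition p r x + transition p q x = m := by
  -- Regrouped by southern indicators, the cocycle consists of differences of angles. When exactly
  -- one patch is southern, a single difference between two equatorial branches survives; in every
  -- other case the sum is zero.
  have key : transition q r x - transition p r x + transition p q x =
      q.isSouth * (r.angle x - p.angle x) + r.isSouth * (p.angle x - q.angle x)
        + p.isSouth * (q.angle x - r.angle x) := by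
    unfold transition
    ring
  rw [key]
  by_cases hs : x ∈ Patch.south.opens
  · rcases Patch.of_mem_south hs hp with rfl | ⟨p1, p2, -⟩ <;>
    rcases Patch.of_mem_south hs hq with rfl | ⟨q1, q2, -⟩ <;>
    rcases Patch.of_mem_south hs hr with rfl | ⟨r1, r2, -⟩
    · exact ⟨0, by simp⟩
    · exact ⟨0, by rw [r1]; push_cast; ring⟩
    · exact ⟨0, by rw [q1]; push_cast; ring⟩
    · obtain ⟨m, hm⟩ := Patch.angle_sub_angle q2 r2 hq hr
      exact ⟨m, by rw [q1, r1, hm]; simp [Patch.isSouth]⟩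
    · exact ⟨0, by rw [p1]; push_cast; ring⟩
    · obtain ⟨m, hm⟩ := Patch.angle_sub_angle r2 p2 hr hp
      exact ⟨m, by rw [p1, r1, hm]; simp [Patch.isSouth]⟩
    · obtain ⟨m, hm⟩ := Patch.angle_sub_angle p2 q2 hp hq
      exact ⟨m, by rw [p1, q1, hm]; simp [Patch.isSouth]⟩
    · exact ⟨0, by rw [p1, q1, r1]; simp⟩
  · have h : ∀ t : Patch, x ∈ t.opens → t.isSouth = 0 := by
      intro t ht
      rcases t.isSouth_cases with h | rfl
      · exact h.1
      · exact absurd ht hs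
    exact ⟨0, by rw [h p hp, h q hq, h r hr]; simp⟩

theorem isIntegralForm_omegaPrime : IsIntegralForm omegaPrime := by
  -- The cocycle is already integer-valued on triple overlaps, so rounding serves only to define a
  -- function into `ℤ`. Its continuity is then checked after embedding `ℤ` in `ℝ`.
  have hround {p q r : Patch} {x : S2} (hp : x ∈ p.opens) (hq : x ∈ q.opens) (hr : x ∈ r.opens) :
      transition q r x - transition p r x + transition p q x =
        (round (transition q r x - transition p r x + transition p q x) : ℝ) := by
    obtain ⟨m, hm⟩ := transition_cocycle hp hq hr
    rw [hm, round_intCast]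
  refine ⟨Patch, Patch.opens, fun p => restrictS2 (polePrimitive p.sign), transition,
    fun p q r x => round (transition q r x - transition p r x + transition p q x),
    exists_mem_opens, ?_, ?_, contMDiffOn_transition, ?_, ?_, ?_⟩
  · intro p x₀
    have h : ContDiffOn ℝ ∞ (polePrimitive p.sign) {y | 1 + p.sign * y 2 ≠ 0} :=
      fun y hy => (contDiffAt_polePrimitive hy).contDiffWithinAt
    exact (restrictS2_smoothOn h x₀).mono fun u hu => ⟨hu.1, (Patch.one_add_pos hu.2).ne'⟩
  · exact fun p x hx => restrictS2_polePrimitive_d p.sign_sq (Patch.one_add_pos hx).ne'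
  · exact fun p q x hp hq v => restrictS2_polePrimitive_sub hp hq v
  · exact fun p q r x hp hq hr => hround hp hq hr
  · intro p q r
    rw [Int.isClosedEmbedding_coe_real.isInducing.continuousOn_iff]
    have h1 := (contMDiffOn_transition q r).continuousOn.mono
      (show (p.opens ∩ q.opens ∩ r.opens : Set S2) ⊆ _ from fun x hx => ⟨hx.1.2, hx.2⟩)
    have h2 := (contMDiffOn_transition p r).continuousOn.mono
      (show (p.opens ∩ q.opens ∩ r.opens : Set S2) ⊆ _ from fun x hx => ⟨hx.1.1, hx.2⟩)
    have h3 := (contMDiffOn_transition p q).continuousOn.mono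
      (show (p.opens ∩ q.opens ∩ r.opens : Set S2) ⊆ _ from fun x hx => hx.1)
    exact ((h1.sub h2).add h3).congr fun x hx => (hround hx.1.1 hx.1.2 hx.2).symm

/-! ### Rotations around the vertical axis -/

/-- The matrix of the generator of the rotations around the vertical axis. -/
def zMatrix : Matrix (Fin 3) (Fin 3) ℝ := !![0, -1, 0; 1, 0, 0; 0, 0, 0]

/-- The rotation by the angle `t` around the vertical axis. -/
def zRotation (t : ℝ) : Matrix (Fin 3) (Fin 3) ℝ :=
  !![Real.cos t, -Real.sin t, 0; Real.sin t, Real.cos t, 0; 0, 0, 1]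

theorem zRotation_eq (t : ℝ) : zRotation t =
    1 + (Real.sin t • zMatrix + (1 - Real.cos t) • (zMatrix * zMatrix)) := by
  ext i j
  fin_cases i <;> fin_cases j <;> simp [zRotation, zMatrix]

theorem zMatrix_mul_mul : zMatrix * zMatrix * zMatrix = -zMatrix := by
  ext i j
  fin_cases i <;> fin_cases j <;> simp [zMatrix, Matrix.mul_apply, Fin.sum_univ_three]

/-- Since `Z³ = -Z`, the rotation `R` satisfies `R' = R Z`. Hence `R(t) exp(-tZ)` has zero
derivative and equals its value `1` at `t = 0`. -/
theorem exp_smul_zMatrix (t : ℝ) : NormedSpace.exp (t • zMatrix) = zRotation t := by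
  let _ : NormedRing (Matrix (Fin 3) (Fin 3) ℝ) := Matrix.linftyOpNormedRing
  let _ : NormedAlgebra ℝ (Matrix (Fin 3) (Fin 3) ℝ) := Matrix.linftyOpNormedAlgebra
  let _ : NormedAlgebra ℚ (Matrix (Fin 3) (Fin 3) ℝ) := .restrictScalars ℚ ℝ _
  have hR : ∀ s, HasDerivAt zRotation
      (Real.cos s • zMatrix + Real.sin s • (zMatrix * zMatrix)) s := by
    intro s
    have h := (((Real.hasDerivAt_sin s).smul_const zMatrix).add
      (((Real.hasDerivAt_cos s).const_sub 1).smul_const (zMatrix * zMatrix))).const_add 1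
    rw [neg_neg] at h
    rw [funext zRotation_eq]
    exact h
  have hf : ∀ s, HasDerivAt (fun s => zRotation s * NormedSpace.exp (s • -zMatrix)) 0 s := by
    intro s
    have h := (hR s).mul (hasDerivAt_exp_smul_const' (𝕂 := ℝ) (-zMatrix) s)
    have h0 : Real.cos s • zMatrix + Real.sin s • (zMatrix * zMatrix) =
        zRotation s * zMatrix := by
      rw [zRotation_eq, add_mul, add_mul, one_mul, smul_mul_assoc, smul_mul_assoc,
        zMatrix_mul_mul]
      module
    have h1 : (Real.cos s • zMatrix + Real.sin s • (zMatrix * zMatrix)) *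
        NormedSpace.exp (s • -zMatrix) +
        zRotation s * (-zMatrix * NormedSpace.exp (s • -zMatrix)) = 0 := by
      rw [h0]
      noncomm_ring
    exact h.congr_deriv h1
  have hc := is_const_of_deriv_eq_zero (fun s => (hf s).differentiableAt)
    (fun s => (hf s).deriv) t 0
  have h0 : zRotation 0 = 1 := by
    rw [zRotation_eq]
    simp
  rw [h0, zero_smul, NormedSpace.exp_zero, one_mul] at hc
  have hi : NormedSpace.exp (t • -zMatrix) * NormedSpace.exp (t • zMatrix) = 1 := by
    have h : Commute (t • -zMatrix) (t • zMatrix) := by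
      rw [smul_neg]
      exact (Commute.refl _).neg_left
    refine (Matrix.exp_add_of_commute _ _ h).symm.trans ?_
    rw [smul_neg, neg_add_cancel, NormedSpace.exp_zero]
  calc NormedSpace.exp (t • zMatrix)
      = zRotation t * NormedSpace.exp (t • -zMatrix) * NormedSpace.exp (t • zMatrix) := by
        rw [hc, one_mul]
    _ = zRotation t := by rw [mul_assoc, hi, mul_one]

theorem coe_expSO3_smul_zGenerator (t : ℝ) :
    (expSO3 (t • zGenerator) : Matrix (Fin 3) (Fin 3) ℝ) = zRotation t :=
  exp_smul_zMatrix t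

theorem expSO3_smul_zGenerator_add (s t : ℝ) :
    expSO3 ((s + t) • zGenerator) = expSO3 (s • zGenerator) * expSO3 (t • zGenerator) := by
  apply Subtype.ext
  change _ = (expSO3 (s • zGenerator) : Matrix (Fin 3) (Fin 3) ℝ) *
    (expSO3 (t • zGenerator) : Matrix (Fin 3) (Fin 3) ℝ)
  rw [coe_expSO3_smul_zGenerator, coe_expSO3_smul_zGenerator, coe_expSO3_smul_zGenerator]
  ext i j
  fin_cases i <;> fin_cases j <;>
    simp [zRotation, Matrix.mul_apply, Fin.sum_univ_three, Real.cos_add, Real.sin_add] <;> ring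

theorem expSO3_two_pi : expSO3 ((2 * Real.pi) • zGenerator) = 1 := by
  apply Subtype.ext
  rw [coe_expSO3_smul_zGenerator, zRotation_eq]
  simp

theorem expSO3_neg_two_pi : expSO3 ((-(2 * Real.pi)) • zGenerator) = 1 := by
  apply Subtype.ext
  rw [coe_expSO3_smul_zGenerator, zRotation_eq]
  simp

theorem expSO3_smul_northPole (t : ℝ) : expSO3 (t • zGenerator) • northPole = northPole := by
  apply Subtype.ext
  rw [coe_smul_S2, coe_expSO3_smul_zGenerator, matCLM_apply]
  ext i
  fin_cases i <;> simp [zRotation, northPole, Matrix.mulVec, dotProduct, Fin.sum_univ_three]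

theorem muPrime_northPole : muPrime ((-(2 * Real.pi)) • zGenerator) northPole = 1 / 2 := by
  have hp := Real.pi_ne_zero
  rw [muPrime_apply, inner_E3]
  simp [axisVec, northPole, zGenerator]
  field_simp
  norm_num

/-! ### One-parameter subgroups of the circle -/

/-- The homomorphism property gives `z' = a z` with `a = z'(0)`, so `z(t) = exp(at)`. As `|z(1)| =
1`, `a` is purely imaginary, and `κ` is its imaginary part. -/
theorem exists_circleExp_of_contMDiff {z : ℝ → Circle} (hz : ContMDiff 𝓘(ℝ, ℝ) (𝓡 1) ∞ z)
    (hadd : ∀ s t, z (s + t) = z s * z t) : ∃ κ : ℝ, ∀ t, z t = Circle.exp (κ * t) := by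
  have : Fact (Module.finrank ℝ ℂ = 1 + 1) := finrank_real_complex_fact'
  have hval : ContMDiff (𝓡 1) 𝓘(ℝ, ℂ) ∞ (fun c : Circle => (c : ℂ)) :=
    contMDiff_coe_sphere (E := ℂ) (n := 1)
  have hw : Differentiable ℝ fun t => (z t : ℂ) :=
    (hval.comp hz).contDiff.differentiable (by simp)
  set a : ℂ := deriv (fun t => (z t : ℂ)) 0 with ha
  have h0 : z 0 = 1 := by
    have h := hadd 0 0
    rw [add_zero] at h
    exact left_eq_mul.1 h
  have hd : ∀ t, HasDerivAt (fun t => (z t : ℂ)) (a * z t) t := by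
    intro t
    have h1 : HasDerivAt (fun s => (z s : ℂ)) a (t - t) := by
      rw [sub_self]
      exact (hw 0).hasDerivAt
    have h2 := (h1.comp_sub_const t t).mul_const (z t : ℂ)
    refine h2.congr_of_eventuallyEq (Filter.Eventually.of_forall fun s => ?_)
    change (z s : ℂ) = z (s - t) * z t
    rw [← Circle.coe_mul, ← hadd, sub_add_cancel]
  have he : ∀ t : ℝ, HasDerivAt (fun t : ℝ => Complex.exp (-(a * t)))
      (-a * Complex.exp (-(a * t))) t := by
    intro t
    have h1 : HasDerivAt (fun t : ℝ => -(a * (t : ℂ))) (-a) t := by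
      have h := ((Complex.ofRealCLM.hasDerivAt (x := t)).const_mul a).neg
      rw [Complex.ofRealCLM_apply, Complex.ofReal_one, mul_one] at h
      exact h
    have h2 := h1.cexp
    rwa [mul_comm] at h2
  have hc : ∀ t : ℝ, (z t : ℂ) = Complex.exp (a * t) := by
    intro t
    have h1 : ∀ s, HasDerivAt (fun s : ℝ => (z s : ℂ) * Complex.exp (-(a * s))) 0 s := by
      intro s
      have h2 := (hd s).mul (he s)
      have h3 : a * (z s : ℂ) * Complex.exp (-(a * s)) +
          (z s : ℂ) * (-a * Complex.exp (-(a * s))) = 0 := by ring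
      rw [h3] at h2
      exact h2
    have h4 := is_const_of_deriv_eq_zero (fun s => (h1 s).differentiableAt)
      (fun s => (h1 s).deriv) t 0
    simp only [h0, Circle.coe_one, Complex.ofReal_zero, mul_zero, neg_zero, Complex.exp_zero,
      mul_one] at h4
    rw [Complex.exp_neg] at h4
    exact (mul_inv_eq_one₀ (Complex.exp_ne_zero _)).1 h4
  have hre : a.re = 0 := by
    have h1 := congrArg norm (hc 1)
    rw [Circle.norm_coe, Complex.norm_exp] at h1
    simpa using h1.symm
  refine ⟨a.im, fun t => Circle.ext ?_⟩
  rw [hc, Circle.coe_exp]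
  congr 1
  apply Complex.ext <;> simp [hre]

/-! ### Prequantum bundles -/

section Bundle

variable {P : Type*} [TopologicalSpace P] [ChartedSpace (EuclideanSpace ℝ (Fin (2 + 1))) P]

/-- `IsSmoothAction` is smoothness along a subset of matrix space; the rotations form a curve with
explicit smooth entries inside that subset. -/
theorem contMDiff_zRotation_smul [MulAction SO3 P] (hA : IsSmoothAction (2 + 1) P) (y : P) :
    ContMDiff 𝓘(ℝ, ℝ) (𝓡 (2 + 1)) ∞ fun t : ℝ => expSO3 ((2 * Real.pi * t) • zGenerator) • y := by
  have hR : ContDiff ℝ ∞ fun t : ℝ => (fun i j => zRotation (2 * Real.pi * t) i j :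
      Fin 3 → Fin 3 → ℝ) := by
    refine contDiff_pi.2 fun i => contDiff_pi.2 fun j => ?_
    have ht : ContDiff ℝ ∞ fun t : ℝ => 2 * Real.pi * t := contDiff_const.mul contDiff_id
    fin_cases i <;> fin_cases j <;> simp [zRotation] <;> first
      | exact contDiff_const
      | exact Real.contDiff_cos.comp ht
      | exact Real.contDiff_sin.comp ht
      | exact (Real.contDiff_sin.comp ht).neg
  have hmem : ∀ t : ℝ, Matrix.of (fun i j => zRotation (2 * Real.pi * t) i j) ∈
      Matrix.specialOrthogonalGroup (Fin 3) ℝ := fun t =>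
    coe_expSO3_smul_zGenerator (2 * Real.pi * t) ▸ (expSO3 ((2 * Real.pi * t) • zGenerator)).2
  have h := hA.comp (hR.contMDiff.prodMk (contMDiff_const (c := y))).contMDiffOn (s := Set.univ)
    fun t _ => hmem t
  refine (contMDiffOn_univ.1 h).congr fun t => ?_
  simp only [Function.comp]
  rw [dif_pos (hmem t)]
  congr 1
  exact Subtype.ext (coe_expSO3_smul_zGenerator (2 * Real.pi * t))

theorem mdifferentiableAt_circleExp_smul [MulAction Circle P] {M : Type*} [TopologicalSpace M]
    [ChartedSpace (EuclideanSpace ℝ (Fin 2)) M] {p : P → M} (hp : IsCircleBundle (n := 2) p)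
    (y : P) :
    MDifferentiableAt 𝓘(ℝ, ℝ) (𝓡 (2 + 1)) (fun t : ℝ => Circle.exp t • y) 0 :=
  ((hp.smooth_action.comp (contMDiff_circleExp.prodMk (contMDiff_const (c := y))))
    0).mdifferentiableAt (by simp)

theorem not_hasMomentum_muPrime [MulAction Circle P] [MulAction SO3 P] {p : P → S2}
    {Ξ : DForm (2 + 1) P 1 ℂ}
    (hp : IsCircleBundle (n := 2) p) (he : IsEquivariantBundle (n := 2) p) (hΞ : IsConnection Ξ) :
    ¬ HasMomentum p Ξ muPrime := by
  intro hm
  obtain ⟨e, hx, hesm, -, hsmul⟩ := hp.locally_trivial northPole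
  -- With fibre coordinate `1` at `y`, the fibre coordinate of `w • y` is `w` itself, so `z` can be
  -- read off from the trivialization.
  obtain ⟨y, hy⟩ : ∃ y, y = e.toOpenPartialHomeomorph.symm (northPole, 1) := ⟨_, rfl⟩
  have hpy : p y = northPole := by
    rw [hy]
    exact e.proj_symm_apply' hx
  have hey : (e y).2 = 1 := by
    rw [hy]
    exact congrArg Prod.snd (e.apply_symm_apply' hx)
  set c : ℝ → P := fun t => expSO3 ((2 * Real.pi * t) • zGenerator) • y with hc
  have hcs : ContMDiff 𝓘(ℝ, ℝ) (𝓡 (2 + 1)) ∞ c := contMDiff_zRotation_smul he.smooth_action y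
  have hpc : ∀ t, p (c t) = northPole := fun t => by
    rw [hc, he.proj_smul, hpy, expSO3_smul_northPole]
  have hsrc : ∀ t, c t ∈ e.source := fun t => e.mem_source.2 ((hpc t).symm ▸ hx)
  set z : ℝ → Circle := fun t => (e (c t)).2 with hz
  have hpz : ∀ w : Circle, (e (w • y)).2 = w := fun w => by
    rw [hsmul y (hpy.symm ▸ hx), hey, mul_one]
  have hcz : ∀ t, c t = z t • y := by
    intro t
    have hs : z t • y ∈ e.source := e.mem_source.2 (by rwa [hp.proj_smul, hpy])
    refine e.injOn (hsrc t) hs (Prod.ext ?_ ?_)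
    · refine (e.coe_fst (hsrc t)).trans (Eq.trans ?_ (e.coe_fst hs).symm)
      rw [hpc, hp.proj_smul, hpy]
    · exact (hpz (z t)).symm
  have hzs : ContMDiff 𝓘(ℝ, ℝ) (𝓡 1) ∞ z :=
    contMDiff_snd.comp (contMDiffOn_univ.1 (hesm.comp hcs.contMDiffOn fun t _ => hsrc t))
  -- The rotation by `s` passes through the scalar `z t` because the two actions commute.
  have hadd : ∀ s t, z (s + t) = z s * z t := by
    intro s t
    have h1 : c (s + t) = (z s * z t) • y := by
      have h2 : c (s + t) = expSO3 ((2 * Real.pi * s) • zGenerator) • c t := by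
        rw [hc]
        simp only
        rw [mul_add, expSO3_smul_zGenerator_add, mul_smul]
      rw [h2, hcz t, he.commutes]
      change z t • c s = _
      rw [hcz s, smul_smul, mul_comm]
    rw [hz]
    simp only
    rw [h1, hpz]
  obtain ⟨κ, hκ⟩ := exists_circleExp_of_contMDiff hzs hadd
  have hfield : fundamentalField ((-(2 * Real.pi)) • zGenerator) y = κ • circleField (n := 2) y := by
    -- The chain rule needs the derivative at `κ * 0`, equal to `0` only propositionally; hence the
    -- quantification over `s`.
    have hg : ∀ s : ℝ, s = 0 → HasMFDerivAt 𝓘(ℝ, ℝ) (𝓡 (2 + 1)) (fun t : ℝ => Circle.exp t • y) s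
        (mfderiv 𝓘(ℝ, ℝ) (𝓡 (2 + 1)) (fun t : ℝ => Circle.exp t • y) 0 :
          ℝ →L[ℝ] EuclideanSpace ℝ (Fin (2 + 1))) := by
      rintro _ rfl
      exact (mdifferentiableAt_circleExp_smul hp y).hasMFDerivAt
    have hl : HasMFDerivAt 𝓘(ℝ, ℝ) 𝓘(ℝ, ℝ) (fun t : ℝ => κ * t) 0
        (κ • ContinuousLinearMap.id ℝ ℝ) :=
      ((hasFDerivAt_id (𝕜 := ℝ) (0 : ℝ)).const_mul κ).hasMFDerivAt
    have hcomp := ((hg (κ * 0) (mul_zero κ)).comp 0 hl).mfderiv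
    have hfun : (fun t : ℝ => expSO3 (-(t • ((-(2 * Real.pi)) • zGenerator))) • y) =
        (fun t : ℝ => Circle.exp t • y) ∘ fun t : ℝ => κ * t := by
      funext t
      -- The sign in `exp(-tX)` cancels the one in `-2π`, so the curve is exactly `c`.
      have h1 : -(t • ((-(2 * Real.pi)) • zGenerator)) = (2 * Real.pi * t) • zGenerator := by
        module
      rw [h1]
      change c t = Circle.exp (κ * t) • y
      rw [hcz, hκ]
    unfold fundamentalField
    rw [hfun, hcomp]
    exact ContinuousLinearMap.map_smul (mfderiv 𝓘(ℝ, ℝ) (𝓡 (2 + 1))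
      (fun t : ℝ => Circle.exp t • y) 0 : ℝ →L[ℝ] EuclideanSpace ℝ (Fin (2 + 1))) κ (1 : ℝ)
  have hΞκ : Ξ y ![fundamentalField ((-(2 * Real.pi)) • zGenerator) y] = κ • Complex.I := by
    rw [hfield, ← hΞ.vertical y]
    have h := (Ξ y).toMultilinearMap.map_smul_univ (fun _ => κ) ![circleField (n := 2) y]
    rw [Finset.prod_const, Finset.card_univ, Fintype.card_fin, pow_one] at h
    refine Eq.trans ?_ h
    change Ξ y _ = Ξ y _
    congr 1
    funext i
    fin_cases i
    rfl
  have hmom := hm ((-(2 * Real.pi)) • zGenerator) y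
  rw [hpy, muPrime_northPole, hΞκ] at hmom
  have hpi : (Real.pi : ℂ) ≠ 0 := by exact_mod_cast Real.pi_ne_zero
  -- The momentum equation is `1/2 = -(i / 2π) · κ i = κ / 2π`.
  have hκπ : κ = Real.pi := by
    have h1 : (κ : ℂ) = Real.pi := by
      rw [Complex.real_smul] at hmom
      push_cast at hmom
      field_simp at hmom
      rw [Complex.I_sq] at hmom
      linear_combination -hmom
    exact_mod_cast h1
  -- A full turn is the identity of `SO(3)`, whereas `κ = π` makes `z 1` equal to `exp(iπ) = -1`.
  have h1 : z 1 = 1 := by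
    rw [hz]
    simp only [hc]
    rw [mul_one, expSO3_two_pi, one_smul, hey]
  rw [hκ, hκπ, mul_one] at h1
  have h2 := congrArg (fun w : Circle => (w : ℂ)) h1
  simp only [Circle.coe_exp, Complex.exp_pi_mul_I, Circle.coe_one] at h2
  norm_num at h2

end Bundle

theorem not_isEquivariantlyPrequantizable_prime :
    ¬ IsEquivariantlyPrequantizable omegaPrime muPrime := by
  rintro ⟨P, _, _, _, _, p, Ξ, hp, he, hΞ, -, -, hm⟩
  exact not_hasMomentum_muPrime hp he hΞ hm

end EquivPrequant

end

open EquivPrequant in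
theorem mainTheorem10 :
    (IsEquivariantTwoForm omegaPrime muPrime ∧ IsEquivariantlyClosed omegaPrime muPrime) ∧
    IsIntegralForm omegaPrime ∧
    ¬ IsEquivariantlyPrequantizable omegaPrime muPrime ∧
    (∃ Y : so3, Y = (-(2 * Real.pi)) • zGenerator ∧ expSO3 Y = 1 ∧
      (∀ t : ℝ, expSO3 (t • Y) • northPole = northPole) ∧
      Complex.exp (2 * Real.pi * Complex.I * (muPrime Y northPole : ℝ)) = -1) := by
  refine ⟨⟨isEquivariantTwoForm_prime, isEquivariantlyClosed_prime⟩, isIntegralForm_omegaPrime,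
    not_isEquivariantlyPrequantizable_prime, _, rfl, expSO3_neg_two_pi, fun t => ?_, ?_⟩
  · rw [smul_smul]
    exact expSO3_smul_northPole _
  · rw [muPrime_northPole, ← Complex.exp_pi_mul_I]
    congr 1
    push_cast
    ring
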